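/- Let $(W,S)$ be a finite Coxeter system with length function $\ell$ and longest element $w_\circ$. Fix a generalized Cartan matrix for $(W,S)$, that is, reals $a_{st}$ with $a_{ss}=2$, $a_{st}\le 0$ for $s\ne t$, $a_{st}a_{ts}=4\cos^2(\pi/m_{st})$ (where $m_{st}$ is the order of $st$) and $a_{st}=0\Leftrightarrow a_{ts}=0$. Let $W$ act on the real vector space $V$ with basis the simple roots $\Delta=\{\alpha_s : s\in S\}$ by $s(\alpha_t)=\alpha_t-a_{st}\alpha_s$. Let $\Phi=W(\Delta)$, and let $\Phi^+\subset\Phi$ be the set of positive roots, i.e. those that are non-negative combinations of simple roots. The (right) weak order on $W$ is defined by $u\le w$ if and only if $w=uv$ for some $v\in W$ with $\ell(u)+\ell(v)=\ell(w)$. Let $Q=q_1\cdots q_m$ be a word in $S$ whose Demazure product is $w_\circ$. (The Demazure product is built from left to right, starting from $e$, by replacing $w$ with $wq_k$ if $\ell(wq_k)=\ell(w)+1$ and keeping $w$ otherwise.) The subword complex of $Q$ is the simplicial complex of the sets of positions in $Q$ whose complement contains a reduced expression of $w_\circ$. For a facet $I$ and a position $k$, let $r(I,k)=\sigma(\alpha_{q_k})$,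 where $\sigma$ is the product, in order, of the letters $q_z$ with $z<k$ and $z\notin I$. The root configuration of $I$ is the multiset $R(I)=\{\!\{ r(I,i) : i\in I\}\!\}$. Assume that $Q$ is realizing: for every facet $I$, the multiset $R(I)$ is a linear basis of $V$. For facets $I,J$ with $I\smallsetminus i=J\smallsetminus j$, $i\in I$, $j\in J$, the flip from $I$ to $J$ is increasing if $i<j$. The increasing flip order $\prec$ is the transitive closure of the relation given by increasing flips. Then for every $w\in W$ there is a unique facet $\kappa(w)$ with $R(\kappa(w))\subset w(\Phi^+)$, and the map $\kappa$ from $W$ to the set of facets is surjective. For all facets $I\neq J$, $I$ is covered by $J$ in the increasing flip order if and only if there exist $w_I\in\kappa^{-1}(I)$ and $w_J\in\kappa^{-1}(J)$ such that $w_I$ is covered by $w_J$ in the weak order. Thus the increasing flip order is the quotient of the weak order by the fibers of $\kappa$: for all facets $I,J$, one has $I\preceq J$ if and only if $(I,J)$ lies in the transitive closure of the relation $\{(\kappa(u),\kappa(w)) : u\le w \text{ in the weak order}\}$. -/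

import Mathlib

noncomputable section

namespace BrickQuotient

variable {B : Type*} {W : Type*} [Group W] {M : CoxeterMatrix B}

/-! ### Generalized Cartan matrices and the geometric representation -/

/-- A generalized Cartan matrix for the Coxeter matrix `M`. -/
structure GenCartanMatrix (M : CoxeterMatrix B) where
  /-- The entries `a s t`. -/
  a : B → B → ℝ
  diag : ∀ s, a s s = 2
  nonpos : ∀ s t, s ≠ t → a s t ≤ 0
  mul_eq : ∀ s t, a s t * a t s = 4 * Real.cos (Real.pi / M s t) ^ 2
  zero_iff : ∀ s t, a s t = 0 ↔ a t s = 0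

namespace GenCartanMatrix

variable (C : GenCartanMatrix M)

/-- The simple root `α_s` in the vector space `V = B →₀ ℝ`, whose basis is the simple roots. -/
def simpleRoot (s : B) : B →₀ ℝ := Finsupp.single s 1

/-- The linear form `α_t ↦ a s t`. -/
def coroot (s : B) : Module.Dual ℝ (B →₀ ℝ) := Finsupp.linearCombination ℝ (C.a s)

theorem coroot_simpleRoot (s t : B) : C.coroot s (simpleRoot t) = C.a s t := by
  simp [coroot, simpleRoot]

/-- The action of the simple reflection `s` on `V`: the involution `α_t ↦ α_t - a s t • α_s`. -/
def refl (s : B) : (B →₀ ℝ) ≃ₗ[ℝ] (B →₀ ℝ) :=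
  Module.reflection (x := simpleRoot s) (f := C.coroot s)
    (by rw [coroot_simpleRoot, C.diag])

theorem refl_simpleRoot (s t : B) :
    C.refl s (simpleRoot t) = simpleRoot t - C.a s t • simpleRoot s := by
  rw [refl, Module.reflection_apply, coroot_simpleRoot]

open Polynomial.Chebyshev in
/-- The simple reflections on `V` satisfy the Coxeter relations. -/
theorem isLiftable_refl : M.IsLiftable C.refl := by
  intro s t
  apply LinearEquiv.ext
  intro z
  have hst := C.mul_eq s t
  rw [LinearEquiv.coe_one, id]
  unfold refl
  rw [Module.reflection_mul_reflection_pow_apply _ _ (M s t) z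
    (C.a s t * C.a t s - 2) (by rw [coroot_simpleRoot, coroot_simpleRoot])]
  rw [coroot_simpleRoot, coroot_simpleRoot]
  by_cases heq : s = t
  · subst heq
    rw [M.diagonal, C.diag]
    simp
    module
  have hm1 : M s t ≠ 1 := M.off_diagonal s t heq
  rcases Nat.eq_zero_or_pos (M s t) with h0 | hpos
  · rw [h0]; simp
  by_cases hm2 : M s t = 2
  · rw [hm2] at hst ⊢
    have h0 : C.a s t = 0 := by
      have : C.a s t * C.a t s = 0 := by rw [hst]; simp
      rcases mul_eq_zero.1 this with h | h
      · exact h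
      · exact (C.zero_iff s t).2 h
    have h0' := (C.zero_iff s t).1 h0
    simp [h0, h0']
    module
  have h3 : 3 ≤ M s t := by omega
  generalize M s t = m at *
  have hmR : (3 : ℝ) ≤ m := by exact_mod_cast h3
  have hθ : C.a s t * C.a t s - 2 = 2 * Real.cos (2 * Real.pi / m) := by
    rw [hst, show 2 * Real.pi / m = 2 * (Real.pi / m) by ring, Real.cos_two_mul]; ring
  rw [hθ]
  have hsin : Real.sin (2 * Real.pi / m) ≠ 0 := by
    apply ne_of_gt
    apply Real.sin_pos_of_pos_of_lt_pi
    · have := Real.pi_pos; positivity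
    · rw [div_lt_iff₀ (by linarith)]
      nlinarith [Real.pi_pos]
  have key := fun k : ℤ => S_two_mul_real_cos (2 * Real.pi / m) k
  rcases Nat.even_or_odd' m with ⟨p, hp | hp⟩
  · have e1 : ((m : ℤ) - 1) / 2 = p - 1 := by omega
    have e2 : ((m : ℤ) - 2) / 2 = p - 1 := by omega
    have hS : (S ℝ ((p : ℤ) - 1)).eval (2 * Real.cos (2 * Real.pi / m)) = 0 := by
      have := key ((p : ℤ) - 1)
      have hp0 : (p : ℝ) ≠ 0 := by
        intro h
        have : p = 0 := by exact_mod_cast h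
        omega
      rw [show (((p : ℤ) - 1 : ℤ) + 1 : ℝ) * (2 * Real.pi / m) = Real.pi by
        rw [hp]; push_cast; field_simp; ring, Real.sin_pi] at this
      exact (mul_eq_zero.1 this).resolve_right hsin
    rw [e1, e2, hS]
    simp
  · have e1 : ((m : ℤ) - 1) / 2 = p := by omega
    have e2 : ((m : ℤ) - 2) / 2 = p - 1 := by omega
    have e3 : ((m : ℤ) - 3) / 2 = p - 1 := by omega
    have e4 : (m : ℤ) / 2 = p := by omega
    have hS : (S ℝ (p : ℤ)).eval (2 * Real.cos (2 * Real.pi / m)) +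
        (S ℝ ((p : ℤ) - 1)).eval (2 * Real.cos (2 * Real.pi / m)) = 0 := by
      have k1 := key (p : ℤ)
      have k2 := key ((p : ℤ) - 1)
      have hm0 : (2 * (p : ℝ) + 1) ≠ 0 := by positivity
      have : Real.sin ((((p : ℤ) : ℝ) + 1) * (2 * Real.pi / m)) =
          - Real.sin (((((p : ℤ) - 1 : ℤ) : ℝ) + 1) * (2 * Real.pi / m)) := by
        rw [← Real.sin_neg, ← Real.sin_add_two_pi (-_)]
        congr 1
        rw [hp]; push_cast; field_simp; ring
      have h : ((S ℝ (p : ℤ)).eval (2 * Real.cos (2 * Real.pi / m)) +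
        (S ℝ ((p : ℤ) - 1)).eval (2 * Real.cos (2 * Real.pi / m))) *
          Real.sin (2 * Real.pi / m) = 0 := by
        rw [add_mul, k1, k2, this]; ring
      exact (mul_eq_zero.1 h).resolve_right hsin
    rw [e1, e2, e3, e4, hS]
    simp

/-- The action of `W` on `V`, determined by `s ↦ refl s` on the simple reflections. -/
def rep (cs : CoxeterSystem M W) : W →* ((B →₀ ℝ) ≃ₗ[ℝ] (B →₀ ℝ)) :=
  cs.lift ⟨C.refl, C.isLiftable_refl⟩

theorem rep_simple (cs : CoxeterSystem M W) (s t : B) :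
    C.rep cs (cs.simple s) (simpleRoot t) = simpleRoot t - C.a s t • simpleRoot s := by
  rw [rep, cs.lift_apply_simple, refl_simpleRoot]

/-- The root system `Φ = W(Δ)`. -/
def roots (cs : CoxeterSystem M W) : Set (B →₀ ℝ) :=
  {v | ∃ (w : W) (s : B), v = C.rep cs w (simpleRoot s)}

/-- The positive roots: the roots that are non-negative combinations of the simple roots. -/
def posRoots (cs : CoxeterSystem M W) : Set (B →₀ ℝ) :=
  {v | v ∈ C.roots cs ∧ ∀ b, 0 ≤ v b}

end GenCartanMatrix

/-! ### Longest element, Demazure product, weak order -/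

/-- The longest element `w_∘` of a finite Coxeter group. -/
def longest [Finite W] (cs : CoxeterSystem M W) : W :=
  (Finite.exists_max cs.length).choose

/-- The Demazure product of a word, built up from left to right. -/
def demazure (cs : CoxeterSystem M W) (ω : List B) : W :=
  ω.foldl (fun w s => if cs.length (w * cs.simple s) = cs.length w + 1
    then w * cs.simple s else w) 1

/-- The right weak order: `u ≤ w` if `w = u * v` with `ℓ u + ℓ v = ℓ w`. -/
def WeakLE (cs : CoxeterSystem M W) (u w : W) : Prop :=
  ∃ v : W, u * v = w ∧ cs.length u + cs.length v = cs.length w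

/-- The strict right weak order. -/
def WeakLT (cs : CoxeterSystem M W) (u w : W) : Prop := WeakLE cs u w ∧ u ≠ w

/-- `y` covers `x` for the strict order relation `lt`. -/
def CoveredBy {X : Type*} (lt : X → X → Prop) (x y : X) : Prop :=
  lt x y ∧ ∀ z, ¬ (lt x z ∧ lt z y)

/-! ### Subword complexes -/

/-- The subword of `Q` formed by the letters at the positions in `X`, in increasing order. -/
def subword {m : ℕ} (Q : Fin m → B) (X : Finset (Fin m)) : List B :=
  ((List.finRange m).filter (fun k => decide (k ∈ X))).map Q

/-- `I` is a face of the subword complex of `Q`: its complement contains (the positions of)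
a reduced expression of the longest element. -/
def IsFace [Finite W] (cs : CoxeterSystem M W) {m : ℕ} (Q : Fin m → B)
    (I : Finset (Fin m)) : Prop :=
  ∃ X : Finset (Fin m), Disjoint X I ∧
    cs.IsReduced (subword Q X) ∧ cs.wordProd (subword Q X) = longest cs

/-- The facets of the subword complex of `Q`: its inclusion-maximal faces. -/
def Facet [Finite W] (cs : CoxeterSystem M W) {m : ℕ} (Q : Fin m → B) : Type :=
  {I : Finset (Fin m) // Maximal (IsFace cs Q) I}

/-- The root function `r(I, k)`: the image of the simple root `α_{q_k}` under the product, in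
order, of the letters of `Q` at the positions `z < k` with `z ∉ I`. -/
def rootFn (C : GenCartanMatrix M) (cs : CoxeterSystem M W) {m : ℕ} (Q : Fin m → B)
    (I : Finset (Fin m)) (k : Fin m) : B →₀ ℝ :=
  C.rep cs (cs.wordProd (subword Q (Finset.univ.filter (fun z => z < k ∧ z ∉ I))))
    (GenCartanMatrix.simpleRoot (Q k))

/-- `Q` is realizing: the root configuration of every facet (the family of the roots `r(I, i)`
for `i ∈ I`, counted with multiplicity) is a linear basis of `V`. -/
def IsRealizing [Finite W] (C : GenCartanMatrix M) (cs : CoxeterSystem M W) {m : ℕ}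
    (Q : Fin m → B) : Prop :=
  ∀ I : Facet cs Q,
    LinearIndependent ℝ (fun i : {i // i ∈ I.1} => rootFn C cs Q I.1 i.1) ∧
    Submodule.span ℝ (Set.range (fun i : {i // i ∈ I.1} => rootFn C cs Q I.1 i.1)) = ⊤

/-- The root configuration of the facet `I` is contained in `w(Φ⁺)`. -/
def RootConfigIn [Finite W] (C : GenCartanMatrix M) (cs : CoxeterSystem M W) {m : ℕ}
    {Q : Fin m → B} (I : Facet cs Q) (w : W) : Prop :=
  ∀ i ∈ I.1, rootFn C cs Q I.1 i ∈ (fun v => C.rep cs w v) '' C.posRoots cs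

/-- The flip from `I` to `J` is increasing: `I \ i = J \ j` with `i < j`. -/
def IncreasingFlip [Finite W] {cs : CoxeterSystem M W} {m : ℕ} {Q : Fin m → B}
    (I J : Facet cs Q) : Prop :=
  ∃ i ∈ I.1, ∃ j ∈ J.1, i < j ∧ I.1.erase i = J.1.erase j

/-- The strict increasing flip order `≺`: the transitive closure of increasing flips. -/
def FlipLT [Finite W] {cs : CoxeterSystem M W} {m : ℕ} {Q : Fin m → B} :
    Facet cs Q → Facet cs Q → Prop :=
  Relation.TransGen IncreasingFlip

/-- The reflexive closure of the increasing flip order. -/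
def FlipLE [Finite W] {cs : CoxeterSystem M W} {m : ℕ} {Q : Fin m → B}
    (I J : Facet cs Q) : Prop :=
  FlipLT I J ∨ I = J

end BrickQuotient

end

namespace BrickQuotient

open GenCartanMatrix

/-! ### Positivity in the geometric representation -/

/-! Every root has a sign, and the sign of w(α_s) tells whether ws is longer than w
(`root_nonneg_iff`). Proportional roots define the same reflection, so a facet I can be studied
through the reflections t_k in its roots r(I,k). Facets are the complements of reduced words for
w_∘. Hence the roots r(I,k) with k ∉ I are positive, and their reflections run through all
reflections exactly once (`exists_rootRefl_eq`, `rootRefl_injOn_compl`). Each i ∈ I can therefore be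
exchanged with exactly one j ∉ I, the one with t_j = t_i, and this flip is increasing exactly when
r(I,i) is positive (`root_nonneg_iff_flip_lt`).

Existence and uniqueness of κ(w) pass from w to ws. Only the line of w(α_s) changes side, at most
one root of the linearly independent R(I) lies on it, and flipping that position repairs the
configuration (`exists_rootConfigIn_mul_simple`). The starting point is w_∘, where the greedy facet
is the only solution. The same step sends a cover w < ws to an equality or an increasing flip.

Conversely, order V lexicographically in the basis R(I) with r(I,i) as last coordinate. The chamber
w of this order satisfies R(I) ⊂ w(Φ⁺) and has r(I,i) on one of its walls
(`exists_rootConfigIn_of_mem`). This gives surjectivity and lifts each increasing flip to a cover of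
the weak order.

Finally, increasing flips are covers of ≺. The number of elements of a facet to the left of a given
position never grows along increasing flips. A chain from I to J must remove i at some step, and the
counts together with the reflections force that step to be the flip from I to J itself
(`eq_of_flip_between`). -/

/-- Chebyshev polynomials of the second kind, shifted by one, as a function of twice the variable. -/
noncomputable def dihedralCoeff (x : ℝ) : ℕ → ℝ
  | 0 => 0
  | 1 => 1
  | k + 2 => x * dihedralCoeff x (k + 1) - dihedralCoeff x k

theorem dihedralCoeff_two (k : ℕ) : dihedralCoeff 2 k = k := by
  induction k using Nat.twoStepInduction with
  | zero => simp [dihedralCoeff]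
  | one => simp [dihedralCoeff]
  | more k ih1 ih2 =>
    rw [dihedralCoeff, ih1, ih2]; push_cast; ring

theorem sin_mul_dihedralCoeff (θ : ℝ) (k : ℕ) :
    Real.sin θ * dihedralCoeff (2 * Real.cos θ) k = Real.sin (k * θ) := by
  induction k using Nat.twoStepInduction with
  | zero => simp [dihedralCoeff]
  | one => simp [dihedralCoeff]
  | more k ih1 ih2 =>
    have e1 : ((k + 2 : ℕ) : ℝ) * θ = (k + 1 : ℕ) * θ + θ := by push_cast; ring
    have e2 : (k : ℝ) * θ = (k + 1 : ℕ) * θ - θ := by push_cast; ring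
    rw [e2, Real.sin_sub] at ih1
    rw [dihedralCoeff, e1, Real.sin_add]
    linear_combination 2 * Real.cos θ * ih2 - ih1

/-- The value is sin(kπ/n)/sin(π/n). The case n = 0 encodes infinite order: there π/0 = 0, the
argument is 2 and the value is k. -/
theorem dihedralCoeff_nonneg {n : ℕ} (hn : n ≠ 1) {k : ℕ} (hk : n = 0 ∨ k ≤ n) :
    0 ≤ dihedralCoeff (2 * Real.cos (Real.pi / n)) k := by
  rcases Nat.eq_zero_or_pos n with rfl | hpos
  · simp [dihedralCoeff_two]
  have hkn : k ≤ n := hk.resolve_left hpos.ne'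
  have h2 : (2 : ℝ) ≤ n := by exact_mod_cast (by omega : 2 ≤ n)
  have hn0 : (0 : ℝ) < n := by linarith
  have hsin : 0 < Real.sin (Real.pi / n) := by
    apply Real.sin_pos_of_pos_of_lt_pi
    · have := Real.pi_pos; positivity
    · rw [div_lt_iff₀ hn0]; nlinarith [Real.pi_pos]
  have hs : 0 ≤ Real.sin (k * (Real.pi / n)) := by
    apply Real.sin_nonneg_of_nonneg_of_le_pi
    · have := Real.pi_pos; positivity
    · have : (k : ℝ) ≤ n := by exact_mod_cast hkn
      rw [← mul_div_assoc, div_le_iff₀ hn0]; nlinarith [Real.pi_pos]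
  rw [← sin_mul_dihedralCoeff] at hs
  exact nonneg_of_mul_nonneg_right hs hsin

variable {B : Type*} {W : Type*} [Group W] {M : CoxeterMatrix B}

/-- The root `w(α_s)`. -/
noncomputable def root (C : GenCartanMatrix M) (cs : CoxeterSystem M W) (w : W) (s : B) : B →₀ ℝ :=
  C.rep cs w (simpleRoot s)

variable (C : GenCartanMatrix M) (cs : CoxeterSystem M W)

theorem rep_mul_apply (u v : W) (x : B →₀ ℝ) :
    C.rep cs (u * v) x = C.rep cs u (C.rep cs v x) := by
  rw [map_mul]; rfl

theorem rep_one_apply (x : B →₀ ℝ) : C.rep cs 1 x = x := by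
  rw [map_one]; rfl

theorem rep_inv_rep (u : W) (x : B →₀ ℝ) : C.rep cs u⁻¹ (C.rep cs u x) = x := by
  rw [← rep_mul_apply, inv_mul_cancel, rep_one_apply]

theorem rep_rep_inv (u : W) (x : B →₀ ℝ) : C.rep cs u (C.rep cs u⁻¹ x) = x := by
  rw [← rep_mul_apply, mul_inv_cancel, rep_one_apply]

theorem rep_root (u v : W) (s : B) : C.rep cs u (root C cs v s) = root C cs (u * v) s := by
  rw [root, root, rep_mul_apply]

theorem rep_simple_apply (s : B) (x : B →₀ ℝ) :
    C.rep cs (cs.simple s) x = x - C.coroot s x • simpleRoot s := by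
  rw [rep, cs.lift_apply_simple, GenCartanMatrix.refl, Module.reflection_apply]

theorem rep_simple_self (s : B) : C.rep cs (cs.simple s) (simpleRoot s) = -simpleRoot s := by
  rw [rep_simple, C.diag, two_smul]; abel

theorem root_mul_simple (w : W) (s : B) : root C cs (w * cs.simple s) s = -root C cs w s := by
  rw [root, rep_mul_apply, rep_simple_self, map_neg]; rfl

theorem root_one (s : B) : root C cs 1 s = simpleRoot s := rep_one_apply C cs _

theorem simpleRoot_nonneg (s : B) : 0 ≤ (simpleRoot s : B →₀ ℝ) := by
  classical
  intro b
  rw [simpleRoot, Finsupp.single_apply]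
  split_ifs <;> simp

theorem simpleRoot_ne_zero (s : B) : (simpleRoot s : B →₀ ℝ) ≠ 0 := by
  simp [simpleRoot]

theorem root_ne_zero (w : W) (s : B) : root C cs w s ≠ 0 := by
  rw [root, ne_eq, LinearEquiv.map_eq_zero_iff]
  exact simpleRoot_ne_zero s

/-- Replacing α_t by cα_t symmetrizes the rank-two Cartan matrix, with both off-diagonal entries
equal to -2cos(π/m). The orbit of α_s then obeys the Chebyshev recurrence. -/
theorem exists_rep_alternatingWord (s t : B) (hst : s ≠ t) :
    ∃ c : ℝ, 0 < c ∧ ∀ k : ℕ,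
      root C cs (cs.wordProd (CoxeterSystem.alternatingWord s t k)) s =
        if Even k then
          dihedralCoeff (2 * Real.cos (Real.pi / M s t)) (k + 1) • simpleRoot s +
            (c * dihedralCoeff (2 * Real.cos (Real.pi / M s t)) k) • simpleRoot t
        else
          dihedralCoeff (2 * Real.cos (Real.pi / M s t)) k • simpleRoot s +
            (c * dihedralCoeff (2 * Real.cos (Real.pi / M s t)) (k + 1)) • simpleRoot t := by
  have hm1 : M s t ≠ 1 := M.off_diagonal s t hst
  set x := 2 * Real.cos (Real.pi / M s t) with hx
  have hx0 : 0 ≤ x := by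
    have := dihedralCoeff_nonneg (n := M s t) (k := 2) hm1 (by omega)
    rw [← hx] at this
    simpa [dihedralCoeff] using this
  have hmul : C.a s t * C.a t s = x ^ 2 := by rw [C.mul_eq, hx]; ring
  have h1 := C.nonpos s t hst
  have h2 := C.nonpos t s hst.symm
  obtain ⟨c, hc, hts, hst'⟩ : ∃ c : ℝ, 0 < c ∧ C.a t s = -(x * c) ∧ c * C.a s t = -x := by
    rcases eq_or_lt_of_le h1 with h0 | h0
    · have h0' := (C.zero_iff s t).1 h0
      have : x = 0 := by
        rw [h0, zero_mul] at hmul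
        exact pow_eq_zero_iff (two_ne_zero) |>.1 hmul.symm
      exact ⟨1, one_pos, by rw [h0', this]; simp, by rw [h0, this]; simp⟩
    · have h0' : C.a t s < 0 := lt_of_le_of_ne h2 fun h => h0.ne ((C.zero_iff s t).2 h)
      have hxp : 0 < x := by
        refine lt_of_le_of_ne hx0 fun h => ?_
        rw [← h] at hmul
        nlinarith
      refine ⟨-C.a t s / x, by apply div_pos <;> linarith, by field_simp, ?_⟩
      field_simp
      linarith
  refine ⟨c, hc, fun k => ?_⟩
  induction k with
  | zero =>
    simp [CoxeterSystem.alternatingWord, root_one, dihedralCoeff]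
  | succ k ih =>
    rw [CoxeterSystem.alternatingWord_succ', cs.wordProd_cons, ← rep_root, ih]
    have hu : dihedralCoeff x (k + 2) = x * dihedralCoeff x (k + 1) - dihedralCoeff x k := rfl
    by_cases hk : Even k
    · have hk' : ¬ Even (k + 1) := by simpa [Nat.even_add_one] using hk
      rw [if_pos hk, if_pos hk, if_neg hk', map_add, map_smul, map_smul, rep_simple,
        rep_simple_self, hts, hu]
      module
    · have hk' : Even (k + 1) := by simpa [Nat.even_add_one] using hk
      rw [if_neg hk, if_neg hk, if_pos hk', map_add, map_smul, map_smul, rep_simple_self,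
        rep_simple, hu]
      have : (c * dihedralCoeff x (k + 1)) • (C.a s t • (simpleRoot s : B →₀ ℝ)) =
          (-(x * dihedralCoeff x (k + 1))) • simpleRoot s := by
        rw [smul_smul]
        congr 1
        linear_combination dihedralCoeff x (k + 1) * hst'
      rw [smul_sub, this]
      module

/-- By the braid relation, the longest alternating suffix can be rewritten to end in s instead of t,
so s is a descent. -/
theorem length_mul_alternatingWord_lt {s t : B} (hm : M s t ≠ 0) {v w : W}
    (hw : w = v * cs.wordProd (CoxeterSystem.alternatingWord s t (M s t)))
    (hl : cs.length w = cs.length v + M s t) :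
    cs.length (w * cs.simple s) < cs.length w := by
  obtain ⟨n, hn⟩ := Nat.exists_eq_succ_of_ne_zero hm
  have hb := cs.wordProd_braidWord_eq s t
  unfold CoxeterSystem.braidWord at hb
  rw [hb, M.symmetric t s, hn, CoxeterSystem.alternatingWord_succ, cs.wordProd_concat] at hw
  have : w * cs.simple s = v * cs.wordProd (CoxeterSystem.alternatingWord s t n) := by
    rw [hw, mul_assoc, mul_assoc, cs.simple_mul_simple_self, mul_one]
  rw [this]
  have h1 := cs.length_mul_le v (cs.wordProd (CoxeterSystem.alternatingWord s t n))
  have h2 := cs.length_wordProd_le (CoxeterSystem.alternatingWord s t n)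
  rw [CoxeterSystem.length_alternatingWord] at h2
  omega

/-- Strip the alternating suffix in s and t off w until neither is a descent. The bound on k makes
both coefficients k and k + 1 of the dihedral root non-negative. -/
theorem exists_dihedral_factorization {w : W} {s t : B}
    (hs : cs.length w < cs.length (w * cs.simple s))
    (ht : cs.length (w * cs.simple t) < cs.length w) :
    ∃ (v : W) (k : ℕ), w = v * cs.wordProd (CoxeterSystem.alternatingWord s t k) ∧
      cs.length v < cs.length w ∧ cs.length v < cs.length (v * cs.simple s) ∧
      cs.length v < cs.length (v * cs.simple t) ∧ (M s t = 0 ∨ k + 1 ≤ M s t) := by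
  classical
  let p : ℕ → Prop := fun k => ∃ v : W,
    w = v * cs.wordProd (CoxeterSystem.alternatingWord s t k) ∧ cs.length w = cs.length v + k
  -- Take the first k at which the suffix cannot be extended; it is at least 1 because t is a
  -- descent of w.
  have hex : ∃ k, ¬ p (k + 1) := by
    refine ⟨cs.length w, ?_⟩
    rintro ⟨v, -, h⟩
    omega
  obtain ⟨k, hk, hmin⟩ : ∃ k, ¬ p (k + 1) ∧ ∀ j < k, p (j + 1) :=
    ⟨Nat.find hex, Nat.find_spec hex, fun j hj => not_not.1 (Nat.find_min hex hj)⟩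
  have hp0 : p 0 := ⟨w, by simp [CoxeterSystem.alternatingWord], by simp⟩
  have hp : ∀ j ≤ k, p j := by
    intro j hj
    cases j with
    | zero => exact hp0
    | succ j => exact hmin j hj
  have hp1 : p 1 := by
    refine ⟨w * cs.simple t, ?_, ?_⟩
    · simp [CoxeterSystem.alternatingWord]
    · rcases cs.length_mul_simple w t with h | h <;> omega
  have hk1 : k ≠ 0 := by rintro rfl; exact hk hp1
  obtain ⟨v, hw, hl⟩ := hp k le_rfl
  obtain ⟨n, rfl⟩ := Nat.exists_eq_succ_of_ne_zero hk1
  have hnext : cs.length v < cs.length (v * cs.simple (if Even (n + 1) then t else s)) := by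
    by_contra hcon
    apply hk
    refine ⟨v * cs.simple (if Even (n + 1) then t else s), ?_, ?_⟩
    · rw [CoxeterSystem.alternatingWord_succ' _ _ (n + 1), cs.wordProd_cons, ← mul_assoc,
        cs.simple_mul_simple_cancel_right]
      exact hw
    · rcases cs.length_mul_simple v (if Even (n + 1) then t else s) with h | h <;>
        simp only [Nat.succ_eq_add_one] at * <;> omega
  have hprev : cs.length v < cs.length (v * cs.simple (if Even n then t else s)) := by
    rw [Nat.succ_eq_add_one, CoxeterSystem.alternatingWord_succ', cs.wordProd_cons, ← mul_assoc] at hw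
    have h1 := cs.length_mul_le (v * cs.simple (if Even n then t else s))
      (cs.wordProd (CoxeterSystem.alternatingWord s t n))
    have h2 := cs.length_wordProd_le (CoxeterSystem.alternatingWord s t n)
    rw [CoxeterSystem.length_alternatingWord] at h2
    rw [← hw] at h1
    omega
  have hboth : cs.length v < cs.length (v * cs.simple s) ∧
      cs.length v < cs.length (v * cs.simple t) := by
    by_cases hn : Even n
    · have hn' : ¬ Even (n + 1) := by simpa [Nat.even_add_one] using hn
      rw [if_pos hn] at hprev
      rw [if_neg hn'] at hnext
      exact ⟨hnext, hprev⟩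
    · have hn' : Even (n + 1) := by simpa [Nat.even_add_one] using hn
      rw [if_neg hn] at hprev
      rw [if_pos hn'] at hnext
      exact ⟨hprev, hnext⟩
  refine ⟨v, n + 1, hw, by omega, hboth.1, hboth.2, ?_⟩
  -- A suffix of length m_st would make s a descent of w, by the braid relation.
  by_contra! hcon
  obtain ⟨v', hw', hl'⟩ := hp (M s t) (by omega)
  have := length_mul_alternatingWord_lt cs hcon.1 hw' hl'
  omega

/-- The root `w(α_s)` is non-negative if `ℓ(ws) > ℓ(w)`. -/
theorem root_nonneg_of_length_lt {w : W} {s : B} (hs : cs.length w < cs.length (w * cs.simple s)) :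
    0 ≤ root C cs w s := by
  induction hn : cs.length w using Nat.strong_induction_on generalizing w s with
  | _ n ih =>
  by_cases hw1 : w = 1
  · rw [hw1, root_one]; exact simpleRoot_nonneg s
  obtain ⟨t, ht⟩ := cs.exists_rightDescent_of_ne_one hw1
  have ht' : cs.length (w * cs.simple t) < cs.length w := ht
  have hst : s ≠ t := by rintro rfl; omega
  obtain ⟨v, k, hw, hlt, hvs, hvt, hk⟩ := exists_dihedral_factorization cs hs ht'
  have h1 := ih _ (by omega) hvs rfl
  have h2 := ih _ (by omega) hvt rfl
  obtain ⟨c, hc, hroot⟩ := exists_rep_alternatingWord C cs s t hst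
  have hm1 : M s t ≠ 1 := M.off_diagonal s t hst
  have e1 := dihedralCoeff_nonneg (n := M s t) hm1 (k := k) (by omega)
  have e2 := dihedralCoeff_nonneg (n := M s t) hm1 (k := k + 1) (by omega)
  rw [hw, ← rep_root, hroot]
  split_ifs
  · rw [map_add, map_smul, map_smul]
    exact add_nonneg (smul_nonneg e2 h1) (smul_nonneg (mul_nonneg hc.le e1) h2)
  · rw [map_add, map_smul, map_smul]
    exact add_nonneg (smul_nonneg e1 h1) (smul_nonneg (mul_nonneg hc.le e2) h2)

theorem root_nonpos_of_length_lt {w : W} {s : B} (hs : cs.length (w * cs.simple s) < cs.length w) :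
    root C cs w s ≤ 0 := by
  have := root_nonneg_of_length_lt C cs (w := w * cs.simple s) (s := s)
    (by rwa [cs.simple_mul_simple_cancel_right])
  rw [root_mul_simple] at this
  exact neg_nonneg.1 this

theorem root_nonneg_iff {w : W} {s : B} :
    0 ≤ root C cs w s ↔ cs.length w < cs.length (w * cs.simple s) := by
  refine ⟨fun h => ?_, root_nonneg_of_length_lt C cs⟩
  by_contra hcon
  have h2 := root_nonpos_of_length_lt C cs (w := w) (s := s)
    (lt_of_le_of_ne (not_lt.1 hcon) (cs.length_mul_simple_ne w s))
  exact root_ne_zero C cs w s (le_antisymm h2 h)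

theorem root_nonpos_iff {w : W} {s : B} :
    root C cs w s ≤ 0 ↔ cs.length (w * cs.simple s) < cs.length w := by
  refine ⟨fun h => ?_, root_nonpos_of_length_lt C cs⟩
  by_contra hcon
  have h2 := root_nonneg_of_length_lt C cs (w := w) (s := s)
    (lt_of_le_of_ne (not_lt.1 hcon) (cs.length_mul_simple_ne w s).symm)
  exact root_ne_zero C cs w s (le_antisymm h h2)

theorem not_root_nonneg_iff {w : W} {s : B} : ¬ 0 ≤ root C cs w s ↔ root C cs w s ≤ 0 := by
  rw [root_nonneg_iff, root_nonpos_iff, not_lt]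
  exact ⟨fun h => lt_of_le_of_ne h (cs.length_mul_simple_ne w s), le_of_lt⟩

/-- Faithfulness: a non-trivial element has a descent, and sends that simple root to a non-positive
vector. -/
theorem eq_one_of_rep_eq {w : W} (h : ∀ x, C.rep cs w x = x) : w = 1 := by
  by_contra hw
  obtain ⟨s, hs⟩ := cs.exists_rightDescent_of_ne_one hw
  have h1 := root_nonpos_of_length_lt C cs hs
  rw [root, h] at h1
  exact simpleRoot_ne_zero s (le_antisymm h1 (simpleRoot_nonneg s))

/-! ### Reflections and their root lines -/

theorem rep_conj_simple_apply (u : W) (q : B) (x : B →₀ ℝ) :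
    C.rep cs (u * cs.simple q * u⁻¹) x =
      x - C.coroot q (C.rep cs u⁻¹ x) • root C cs u q := by
  rw [rep_mul_apply, rep_mul_apply, rep_simple_apply, map_sub, rep_rep_inv, map_smul]
  rfl

theorem rep_conj_simple_root (u : W) (q : B) :
    C.rep cs (u * cs.simple q * u⁻¹) (root C cs u q) = - root C cs u q := by
  rw [rep_root, ← root_mul_simple]
  congr 1
  group

/-- Reflections with the same root line are equal. -/
theorem conj_simple_eq_of_root_eq [Finite W] {u v : W} {s t : B} {c : ℝ}
    (h : root C cs u s = c • root C cs v t) :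
    u * cs.simple s * u⁻¹ = v * cs.simple t * v⁻¹ := by
  have hc : c ≠ 0 := by
    rintro rfl
    rw [zero_smul] at h
    exact root_ne_zero C cs u s h
  set β := root C cs v t with hβ
  -- The product of the two reflections is a transvection along β. Its n-th power translates y by
  -- nrβ, so finite order forces r = 0, and faithfulness gives x = 1.
  let x := u * cs.simple s * u⁻¹ * (v * cs.simple t * v⁻¹)
  have hxβ : C.rep cs x β = β := by
    have : β = c⁻¹ • root C cs u s := by rw [h, inv_smul_smul₀ hc]
    rw [rep_mul_apply, rep_conj_simple_root, map_neg, ← hβ]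
    nth_rw 1 [this]
    rw [map_smul, rep_conj_simple_root, smul_neg, neg_neg, ← this]
  have hx : ∀ y, ∃ r : ℝ, C.rep cs x y = y + r • β := by
    intro y
    refine ⟨-(C.coroot t (C.rep cs v⁻¹ y)) -
      c * (C.coroot s (C.rep cs u⁻¹ (C.rep cs (v * cs.simple t * v⁻¹) y))), ?_⟩
    rw [rep_mul_apply, rep_conj_simple_apply C cs u, rep_conj_simple_apply C cs v, h, ← hβ]
    module
  have hx1 : x = 1 := by
    apply eq_one_of_rep_eq C cs
    intro y
    obtain ⟨r, hr⟩ := hx y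
    have hpow : ∀ n : ℕ, C.rep cs (x ^ n) y = y + (n * r) • β := by
      intro n
      induction n with
      | zero => simp
      | succ n ih =>
        rw [pow_succ', rep_mul_apply, ih, map_add, map_smul, hxβ, hr]
        push_cast
        module
    have h0 := hpow (orderOf x)
    rw [pow_orderOf_eq_one, rep_one_apply, left_eq_add, smul_eq_zero] at h0
    have hr0 : r = 0 := by
      rcases h0 with h0 | h0
      · rcases mul_eq_zero.1 h0 with h1 | h1
        · have := orderOf_pos x
          have : orderOf x = 0 := by exact_mod_cast h1
          omega
        · exact h1
      · exact absurd h0 (root_ne_zero C cs v t)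
    rw [hr, hr0, zero_smul, add_zero]
  have h3 : (v * cs.simple t * v⁻¹) * (v * cs.simple t * v⁻¹) = 1 := by
    have := cs.simple_mul_simple_self t
    calc _ = v * (cs.simple t * cs.simple t) * v⁻¹ := by group
      _ = 1 := by rw [this]; group
  exact (eq_inv_of_mul_eq_one_left hx1).trans (eq_inv_of_mul_eq_one_left h3).symm

/-- Equal reflections have the same root line. -/
theorem root_eq_smul_of_conj_simple_eq {u v : W} {s t : B}
    (h : u * cs.simple s * u⁻¹ = v * cs.simple t * v⁻¹) :
    ∃ c : ℝ, c ≠ 0 ∧ root C cs u s = c • root C cs v t := by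
  have h1 := rep_conj_simple_root C cs u s
  rw [h, rep_conj_simple_apply] at h1
  set φ := C.coroot t (C.rep cs v⁻¹ (root C cs u s))
  have h2 : root C cs u s = (φ / 2) • root C cs v t := by
    have : (2 : ℝ) • root C cs u s = φ • root C cs v t := by
      rw [sub_eq_iff_eq_add] at h1
      rw [two_smul]
      nth_rw 1 [h1]
      abel
    rw [div_eq_inv_mul, ← smul_smul, ← this, inv_smul_smul₀ two_ne_zero]
  refine ⟨φ / 2, fun h0 => root_ne_zero C cs u s ?_, h2⟩
  rw [h2, h0, zero_smul]

/-- Signs of roots of equal reflections change simultaneously. -/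
theorem root_nonneg_congr {u v : W} {s t : B}
    (h : u * cs.simple s * u⁻¹ = v * cs.simple t * v⁻¹) (x : W) :
    (0 ≤ root C cs u s ↔ 0 ≤ root C cs v t) ↔
      (0 ≤ root C cs (x * u) s ↔ 0 ≤ root C cs (x * v) t) := by
  obtain ⟨c, hc, hr⟩ := root_eq_smul_of_conj_simple_eq C cs h
  have hr' : root C cs (x * u) s = c • root C cs (x * v) t := by
    rw [← rep_root, hr, map_smul, rep_root]
  -- Both sides of the claim say that the proportionality factor c is positive, and c does not
  -- depend on x.
  have key : ∀ y : W, root C cs (y * u) s = c • root C cs (y * v) t →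
      ((0 ≤ root C cs (y * u) s ↔ 0 ≤ root C cs (y * v) t) ↔ 0 < c) := by
    intro y hy
    constructor
    · intro hiff
      by_contra hneg
      have hneg' : c < 0 := lt_of_le_of_ne (not_lt.1 hneg) hc
      by_cases hp : 0 ≤ root C cs (y * v) t
      · have h1 := hiff.2 hp
        rw [hy] at h1
        have : c • root C cs (y * v) t ≤ 0 := smul_nonpos_of_nonpos_of_nonneg hneg'.le hp
        exact root_ne_zero C cs _ _ (hy.trans (le_antisymm this h1))
      · have h1 := (not_root_nonneg_iff C cs).1 hp
        apply hp
        apply hiff.1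
        rw [hy]
        exact smul_nonneg_of_nonpos_of_nonpos hneg'.le h1
    · intro hpos
      rw [hy]
      exact ⟨fun h1 => by
        have := smul_nonneg (inv_pos.2 hpos).le h1
        rwa [inv_smul_smul₀ hc] at this, fun h1 => smul_nonneg hpos.le h1⟩
  have k1 := key 1 (by rw [one_mul, one_mul, hr])
  rw [one_mul, one_mul] at k1
  rw [k1, key x hr']

/-- A simple reflection makes only the multiples of its simple root change sign. -/
theorem conj_eq_simple_of_sign_change [Finite W] {u : W} {q s : B} (h1 : 0 ≤ root C cs u q)
    (h2 : root C cs (cs.simple s * u) q ≤ 0) : u * cs.simple q * u⁻¹ = cs.simple s := by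
  -- The reflection s alters only the coordinate at s, so every other coordinate is both
  -- non-negative and non-positive.
  have h3 : root C cs u q = (root C cs u q s) • root C cs 1 s := by
    classical
    rw [root_one]
    ext b
    rw [Finsupp.smul_apply, simpleRoot, Finsupp.single_apply]
    split_ifs with hb
    · rw [hb]; simp
    · have h4 := h2 b
      rw [← rep_root, rep_simple_apply, Finsupp.sub_apply, Finsupp.smul_apply, simpleRoot,
        Finsupp.single_apply, if_neg hb] at h4
      have h5 := h1 b
      simp only [Finsupp.coe_zero, Pi.zero_apply, smul_eq_mul, mul_zero, sub_zero] at h4 h5 ⊢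
      exact le_antisymm h4 h5
  have := conj_simple_eq_of_root_eq C cs h3
  simpa using this

theorem rep_nonpos {w : W} (h : ∀ s, root C cs w s ≤ 0) {x : B →₀ ℝ} (hx : 0 ≤ x) :
    C.rep cs w x ≤ 0 := by
  rw [← Finsupp.sum_single x, Finsupp.sum, map_sum]
  refine Finset.sum_nonpos fun s _ => ?_
  have : (Finsupp.single s (x s) : B →₀ ℝ) = x s • simpleRoot s := by simp [simpleRoot]
  rw [this, map_smul]
  exact smul_nonpos_of_nonneg_of_nonpos (hx s) (h s)

theorem simple_injective (C : GenCartanMatrix M) : Function.Injective cs.simple := by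
  intro s t h
  by_contra hst
  have h1 := rep_simple_self C cs s
  rw [h, rep_simple] at h1
  have h2 := DFunLike.congr_fun h1 s
  simp [simpleRoot, Ne.symm hst] at h2
  linarith

/-! ### Signs of roots under the longest element -/

theorem length_le_longest [Finite W] (w : W) : cs.length w ≤ cs.length (longest cs) :=
  (Finite.exists_max cs.length).choose_spec w

theorem root_longest_inv_nonpos [Finite W] (s : B) : root C cs (longest cs)⁻¹ s ≤ 0 :=
  root_nonpos_of_length_lt C cs
    (lt_of_le_of_ne (by rw [cs.length_inv]; exact length_le_longest cs _)
      (cs.length_mul_simple_ne _ s))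

/-- The inverse of the longest element exchanges positive and negative roots. -/
theorem root_longest_inv_mul_nonneg_iff [Finite W] (u : W) (s : B) :
    0 ≤ root C cs ((longest cs)⁻¹ * u) s ↔ root C cs u s ≤ 0 := by
  constructor
  · intro h
    rw [← not_root_nonneg_iff]
    intro h1
    have h2 := rep_nonpos C cs (root_longest_inv_nonpos C cs) h1
    rw [rep_root] at h2
    exact root_ne_zero C cs _ _ (le_antisymm h2 h)
  · intro h
    have h2 := rep_nonpos C cs (root_longest_inv_nonpos C cs) (neg_nonneg.2 h)
    rw [map_neg, rep_root] at h2
    exact neg_nonpos.1 h2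

end BrickQuotient

namespace BrickQuotient

open GenCartanMatrix

/-! ### Subwords and their prefixes -/

section Subword

variable {B : Type*} {m : ℕ} (Q : Fin m → B)

theorem length_subword (X : Finset (Fin m)) : (subword Q X).length = X.card := by
  rw [subword, List.length_map, ← List.toFinset_card_of_nodup ((List.nodup_finRange m).filter _)]
  congr 1
  ext z
  simp

theorem filter_mem_insert_of_lt {k : Fin m} {X : Finset (Fin m)} (hX : ∀ z ∈ X, z < k)
    (l : List (Fin m)) (hl : l.Pairwise (· < ·)) :
    l.filter (fun z => decide (z ∈ insert k X)) =
      l.filter (fun z => decide (z ∈ X)) ++ l.filter (fun z => z == k) := by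
  induction l with
  | nil => rfl
  | cons a l ih =>
    rw [List.pairwise_cons] at hl
    have ih := ih hl.2
    have hk : k ∉ X := fun h => lt_irrefl _ (hX k h)
    by_cases haX : a ∈ X
    · have hak : a ≠ k := (hX a haX).ne
      rw [List.filter_cons_of_pos (by simp [haX]), List.filter_cons_of_pos (by simp [haX]),
        List.filter_cons_of_neg (by simpa using hak), ih, List.cons_append]
    · by_cases hak : a = k
      · subst hak
        have h0 : l.filter (fun z => decide (z ∈ X)) = [] := by
          rw [List.filter_eq_nil_iff]
          intro z hz
          simpa using fun h => lt_asymm (hX z h) (hl.1 z hz)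
        rw [List.filter_cons_of_pos (by simp), List.filter_cons_of_neg (by simp [haX]),
          List.filter_cons_of_pos (by simp), ih, h0, List.nil_append, List.nil_append]
      · rw [List.filter_cons_of_neg (by simp [haX, hak]), List.filter_cons_of_neg (by simp [haX]),
          List.filter_cons_of_neg (by simpa using hak), ih]

theorem subword_insert_of_lt {k : Fin m} {X : Finset (Fin m)} (hX : ∀ z ∈ X, z < k) :
    subword Q (insert k X) = subword Q X ++ [Q k] := by
  have h1 : (List.finRange m).filter (fun z => z == k) = [k] := by
    rw [List.filter_beq, List.count_eq_one_of_mem (List.nodup_finRange m) (List.mem_finRange k)]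
    rfl
  rw [subword, filter_mem_insert_of_lt hX _ (List.pairwise_lt_finRange m), h1, List.map_append]
  rfl

end Subword

variable {B : Type*} {W : Type*} [Group W] {M : CoxeterMatrix B}

/-- The product of the letters at the positions `z < k` with `z ∉ I`. -/
noncomputable def prefixProd (cs : CoxeterSystem M W) {m : ℕ} (Q : Fin m → B)
    (I : Finset (Fin m)) (k : ℕ) : W :=
  cs.wordProd (subword Q (Finset.univ.filter (fun z : Fin m => (z : ℕ) < k ∧ z ∉ I)))

/-- The reflection in the root `r(I, k)`. -/
noncomputable def rootRefl (cs : CoxeterSystem M W) {m : ℕ} (Q : Fin m → B)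
    (I : Finset (Fin m)) (k : Fin m) : W :=
  prefixProd cs Q I k * cs.simple (Q k) * (prefixProd cs Q I k)⁻¹

variable (C : GenCartanMatrix M) (cs : CoxeterSystem M W) {m : ℕ} (Q : Fin m → B)

theorem rootFn_eq_root (I : Finset (Fin m)) (k : Fin m) :
    rootFn C cs Q I k = root C cs (prefixProd cs Q I k) (Q k) := rfl

theorem prefixProd_zero (I : Finset (Fin m)) : prefixProd cs Q I 0 = 1 := by
  rw [prefixProd]
  have : Finset.univ.filter (fun z : Fin m => (z : ℕ) < 0 ∧ z ∉ I) = ∅ := by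
    ext z; simp
  rw [this, subword]
  simp

theorem filter_lt_succ_of_mem {I : Finset (Fin m)} {k : Fin m} (hk : k ∈ I) :
    Finset.univ.filter (fun z : Fin m => (z : ℕ) < k + 1 ∧ z ∉ I) =
      Finset.univ.filter (fun z : Fin m => (z : ℕ) < k ∧ z ∉ I) := by
  ext z
  simp only [Finset.mem_filter, Finset.mem_univ, true_and]
  constructor
  · rintro ⟨h1, h2⟩
    refine ⟨lt_of_le_of_ne (by omega) fun h => h2 ?_, h2⟩
    rwa [Fin.ext h]
  · rintro ⟨h1, h2⟩
    exact ⟨by omega, h2⟩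

theorem filter_lt_succ_of_notMem {I : Finset (Fin m)} {k : Fin m} (hk : k ∉ I) :
    Finset.univ.filter (fun z : Fin m => (z : ℕ) < k + 1 ∧ z ∉ I) =
      insert k (Finset.univ.filter (fun z : Fin m => (z : ℕ) < k ∧ z ∉ I)) := by
  ext z
  simp only [Finset.mem_filter, Finset.mem_univ, true_and, Finset.mem_insert, Fin.ext_iff]
  constructor
  · rintro ⟨h1, h2⟩
    by_cases h : (z : ℕ) = k
    · exact Or.inl h
    · exact Or.inr ⟨by omega, h2⟩
  · rintro (h | ⟨h1, h2⟩)
    · exact ⟨by omega, by rwa [Fin.ext h]⟩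
    · exact ⟨by omega, h2⟩

theorem prefixProd_succ_of_mem {I : Finset (Fin m)} {k : Fin m} (hk : k ∈ I) :
    prefixProd cs Q I (k + 1) = prefixProd cs Q I k := by
  rw [prefixProd, filter_lt_succ_of_mem hk, prefixProd]

theorem prefixProd_succ_of_notMem {I : Finset (Fin m)} {k : Fin m} (hk : k ∉ I) :
    prefixProd cs Q I (k + 1) = prefixProd cs Q I k * cs.simple (Q k) := by
  rw [prefixProd, filter_lt_succ_of_notMem hk, subword_insert_of_lt, cs.wordProd_append,
    cs.wordProd_singleton, prefixProd]
  intro z hz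
  exact (Finset.mem_filter.1 hz).2.1

theorem prefixProd_card (I : Finset (Fin m)) :
    prefixProd cs Q I m = cs.wordProd (subword Q Iᶜ) := by
  rw [prefixProd]
  congr 2
  ext z
  simp

theorem prefixProd_congr {I J : Finset (Fin m)} {n : ℕ}
    (h : ∀ z : Fin m, (z : ℕ) < n → (z ∈ I ↔ z ∈ J)) : prefixProd cs Q I n = prefixProd cs Q J n := by
  rw [prefixProd, prefixProd]
  congr 2
  ext z
  simp only [Finset.mem_filter, Finset.mem_univ, true_and]
  constructor
  · rintro ⟨h1, h2⟩; exact ⟨h1, by rwa [← h z h1]⟩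
  · rintro ⟨h1, h2⟩; exact ⟨h1, by rwa [h z h1]⟩

theorem rootRefl_congr {I J : Finset (Fin m)} {k : Fin m}
    (h : ∀ z : Fin m, z < k → (z ∈ I ↔ z ∈ J)) : rootRefl cs Q I k = rootRefl cs Q J k := by
  rw [rootRefl, rootRefl, prefixProd_congr cs Q h]

theorem rootRefl_mul_self (I : Finset (Fin m)) (k : Fin m) :
    rootRefl cs Q I k * rootRefl cs Q I k = 1 := by
  have := cs.simple_mul_simple_self (Q k)
  rw [rootRefl]
  calc _ = prefixProd cs Q I k * (cs.simple (Q k) * cs.simple (Q k)) * (prefixProd cs Q I k)⁻¹ := by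
        group
    _ = 1 := by rw [this]; group

/-- The number of letters at the positions `z < k` with `z ∉ I`. -/
def prefixCard (I : Finset (Fin m)) (k : ℕ) : ℕ :=
  (Finset.univ.filter (fun z : Fin m => (z : ℕ) < k ∧ z ∉ I)).card

theorem prefixCard_succ_of_mem {I : Finset (Fin m)} {k : Fin m} (hk : k ∈ I) :
    prefixCard I (k + 1) = prefixCard I k := by
  rw [prefixCard, filter_lt_succ_of_mem hk, prefixCard]

theorem prefixCard_succ_of_notMem {I : Finset (Fin m)} {k : Fin m} (hk : k ∉ I) :
    prefixCard I (k + 1) = prefixCard I k + 1 := by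
  rw [prefixCard, filter_lt_succ_of_notMem hk, Finset.card_insert_of_notMem (by simp), prefixCard]

theorem prefixCard_card (I : Finset (Fin m)) : prefixCard I m = Iᶜ.card := by
  rw [prefixCard]
  congr 1
  ext z
  simp

theorem length_prefixProd_le (I : Finset (Fin m)) (k : ℕ) :
    cs.length (prefixProd cs Q I k) ≤ prefixCard I k := by
  rw [prefixProd, prefixCard, ← length_subword Q]
  exact cs.length_wordProd_le _

/-- Each letter raises the length by at most one, so the deficit of a prefix from being reduced can
only grow. -/
theorem length_prefixProd_add_le (I : Finset (Fin m)) {k l : ℕ} (hkl : k ≤ l) (hl : l ≤ m) :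
    cs.length (prefixProd cs Q I l) + prefixCard I k ≤
      cs.length (prefixProd cs Q I k) + prefixCard I l := by
  induction l, hkl using Nat.le_induction with
  | base => exact le_rfl
  | succ l hkl ih =>
    have ih := ih (by omega)
    obtain ⟨z, rfl⟩ : ∃ z : Fin m, (z : ℕ) = l := ⟨⟨l, by omega⟩, rfl⟩
    by_cases hz : z ∈ I
    · rwa [prefixProd_succ_of_mem cs Q hz, prefixCard_succ_of_mem hz]
    · rw [prefixProd_succ_of_notMem cs Q hz, prefixCard_succ_of_notMem hz]
      have := cs.length_mul_simple (prefixProd cs Q I z) (Q z)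
      omega

/-! ### Facets of the subword complex -/

section Facets

variable [Finite W]

theorem isFace_iff_exists_prefixProd {I : Finset (Fin m)} :
    IsFace cs Q I ↔ ∃ J, I ⊆ J ∧ prefixProd cs Q J m = longest cs ∧
      Jᶜ.card = cs.length (longest cs) := by
  constructor
  · rintro ⟨X, hX, hr, hw⟩
    refine ⟨Xᶜ, ?_, ?_, ?_⟩
    · intro z hz
      rw [Finset.mem_compl]
      exact fun h => Finset.disjoint_left.1 hX h hz
    · rw [prefixProd_card, compl_compl, hw]
    · rw [compl_compl, ← hw, hr.eq, length_subword]
  · rintro ⟨J, hJ, hw, hc⟩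
    rw [prefixProd_card] at hw
    refine ⟨Jᶜ, ?_, ?_, hw⟩
    · rw [Finset.disjoint_left]
      intro z hz hzI
      exact Finset.mem_compl.1 hz (hJ hzI)
    · rw [CoxeterSystem.IsReduced, hw, length_subword, hc]

/-- Every face lies in the complement of a reduced word for w_∘, and all these complements have the
same size. -/
theorem maximal_isFace_iff {I : Finset (Fin m)} :
    Maximal (IsFace cs Q) I ↔ prefixProd cs Q I m = longest cs ∧
      Iᶜ.card = cs.length (longest cs) := by
  constructor
  · rintro ⟨h1, h2⟩
    obtain ⟨J, hJ, hw, hc⟩ := (isFace_iff_exists_prefixProd cs Q).1 h1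
    have := h2 ((isFace_iff_exists_prefixProd cs Q).2 ⟨J, subset_rfl, hw, hc⟩) hJ
    rw [Finset.Subset.antisymm hJ this]
    exact ⟨hw, hc⟩
  · rintro ⟨hw, hc⟩
    refine ⟨(isFace_iff_exists_prefixProd cs Q).2 ⟨I, subset_rfl, hw, hc⟩, fun J hJ hIJ => ?_⟩
    obtain ⟨K, hK, -, hKc⟩ := (isFace_iff_exists_prefixProd cs Q).1 hJ
    have h1 : Kᶜ ⊆ Iᶜ := Finset.compl_subset_compl.2 (hIJ.trans hK)
    have h2 := Finset.eq_of_subset_of_card_le h1 (by rw [hc, hKc])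
    rw [compl_inj_iff] at h2
    rwa [← h2]

variable {Q} {cs}

/-- The whole complement of a facet is a reduced word, hence so is each of its prefixes. -/
theorem length_prefixProd {I : Finset (Fin m)} (hI : Maximal (IsFace cs Q) I) {k : ℕ} (hk : k ≤ m) :
    cs.length (prefixProd cs Q I k) = prefixCard I k := by
  have h := (maximal_isFace_iff cs Q).1 hI
  have h1 := length_prefixProd_le cs Q I k
  have h2 := length_prefixProd_add_le cs Q I hk le_rfl
  rw [prefixCard_card, h.1, h.2] at h2
  omega

/-- The roots `r(I, k)` with `k ∉ I` are positive. -/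
theorem root_prefixProd_nonneg {I : Finset (Fin m)} (hI : Maximal (IsFace cs Q) I) {k : Fin m}
    (hk : k ∉ I) : 0 ≤ root C cs (prefixProd cs Q I k) (Q k) := by
  rw [root_nonneg_iff, ← prefixProd_succ_of_notMem cs Q hk, length_prefixProd hI (by omega),
    length_prefixProd hI (by omega), prefixCard_succ_of_notMem hk]
  omega

/-- Every reflection is the reflection in some `r(I, k)` with `k ∉ I`. -/
theorem exists_rootRefl_eq (C : GenCartanMatrix M) {I : Finset (Fin m)}
    (hI : Maximal (IsFace cs Q) I) (u : W) (q : B) :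
    ∃ k, k ∉ I ∧ rootRefl cs Q I k = u * cs.simple q * u⁻¹ := by
  classical
  -- Replacing u by uq negates the root and keeps the reflection.
  wlog hu : 0 ≤ root C cs u q generalizing u
  · obtain ⟨k, hk, h⟩ := this (u * cs.simple q) (by
      rw [root_mul_simple]; exact neg_nonneg.2 ((not_root_nonneg_iff C cs).1 hu))
    exact ⟨k, hk, by rw [h]; group⟩
  have hw := ((maximal_isFace_iff cs Q).1 hI).1
  -- Pulled back by the growing prefixes, the root starts positive and ends negative, since the full
  -- product is w_∘. The first change of sign is caused by a letter outside I, and there the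
  -- pulled-back root is a multiple of that simple root.
  have hex : ∃ k, ¬ 0 ≤ root C cs ((prefixProd cs Q I k)⁻¹ * u) q := by
    refine ⟨m, ?_⟩
    rw [hw, root_longest_inv_mul_nonneg_iff]
    exact fun h => root_ne_zero C cs _ _ (le_antisymm h hu)
  have hspec := Nat.find_spec hex
  have hmin := fun j => Nat.find_min hex (m := j)
  have hle : Nat.find hex ≤ m := Nat.find_min' hex (by
    rw [hw, root_longest_inv_mul_nonneg_iff]
    exact fun h => root_ne_zero C cs _ _ (le_antisymm h hu))
  generalize Nat.find hex = n at *
  cases n with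
  | zero =>
    rw [prefixProd_zero, inv_one, one_mul] at hspec
    exact absurd hu hspec
  | succ n =>
    have hn := not_not.1 (hmin n (Nat.lt_succ_self n))
    obtain ⟨z, rfl⟩ : ∃ z : Fin m, (z : ℕ) = n := ⟨⟨n, by omega⟩, rfl⟩
    have hz : z ∉ I := by
      intro hz
      rw [prefixProd_succ_of_mem cs Q hz] at hspec
      exact hspec hn
    refine ⟨z, hz, ?_⟩
    rw [prefixProd_succ_of_notMem cs Q hz, mul_inv_rev, cs.inv_simple, mul_assoc,
      not_root_nonneg_iff] at hspec
    have := conj_eq_simple_of_sign_change C cs hn hspec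
    rw [rootRefl, ← this]
    group

end Facets

/-! ### Toggling positions -/

/-- Inserting or deleting the letter at i amounts to multiplying all later prefix products on the
left by the reflection t_i. -/
theorem prefixProd_toggle {I J : Finset (Fin m)} {i : Fin m} (h : ∀ k, k ≠ i → (k ∈ J ↔ k ∈ I))
    (hi : i ∈ J ↔ i ∉ I) {k : ℕ} (hk : k ≤ m) :
    prefixProd cs Q J k =
      if (i : ℕ) < k then rootRefl cs Q I i * prefixProd cs Q I k else prefixProd cs Q I k := by
  induction k with
  | zero => simp [prefixProd_zero]
  | succ k ih =>
    have ih := ih (by omega)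
    obtain ⟨z, rfl⟩ : ∃ z : Fin m, (z : ℕ) = k := ⟨⟨k, by omega⟩, rfl⟩
    by_cases hzi : z = i
    · subst hzi
      rw [if_neg (lt_irrefl _)] at ih
      rw [if_pos (Nat.lt_succ_self _), rootRefl]
      by_cases hz : z ∈ I
      · rw [prefixProd_succ_of_mem cs Q hz, prefixProd_succ_of_notMem cs Q (by tauto), ih]
        group
      · rw [prefixProd_succ_of_notMem cs Q hz, prefixProd_succ_of_mem cs Q (by tauto), ih]
        simp [mul_assoc]
    · have hz := h z hzi
      have hlt : (i : ℕ) < z + 1 ↔ (i : ℕ) < z := by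
        have : (z : ℕ) ≠ i := fun h => hzi (Fin.ext h)
        omega
      simp only [hlt]
      by_cases hzI : z ∈ I
      · rw [prefixProd_succ_of_mem cs Q hzI, prefixProd_succ_of_mem cs Q (by tauto), ih]
      · rw [prefixProd_succ_of_notMem cs Q hzI, prefixProd_succ_of_notMem cs Q (by tauto), ih]
        split_ifs
        · rw [mul_assoc]
        · rfl

end BrickQuotient

namespace BrickQuotient

open GenCartanMatrix

variable {B : Type*} {W : Type*} [Group W] {M : CoxeterMatrix B}
variable (C : GenCartanMatrix M) (cs : CoxeterSystem M W) {m : ℕ} (Q : Fin m → B)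

theorem prefixProd_toggle_two {I J : Finset (Fin m)} {i j : Fin m} (hij : i ≠ j)
    (h : ∀ k, k ≠ i → k ≠ j → (k ∈ J ↔ k ∈ I)) (hi : i ∈ J ↔ i ∉ I) (hj : j ∈ J ↔ j ∉ I)
    {k : ℕ} (hk : k ≤ m) :
    prefixProd cs Q J k =
      (if (j : ℕ) < k then
        if i < j then rootRefl cs Q I i * rootRefl cs Q I j * rootRefl cs Q I i
        else rootRefl cs Q I j
      else 1) * (if (i : ℕ) < k then rootRefl cs Q I i else 1) * prefixProd cs Q I k := by
  classical
  -- K toggles only i. Toggling j afterwards uses t_j as seen from K, which is conjugated by t_i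
  -- when i < j.
  obtain ⟨K, hK⟩ : ∃ K : Finset (Fin m), ∀ k, k ∈ K ↔ if k = i then k ∉ I else k ∈ I :=
    ⟨Finset.univ.filter fun k => if k = i then k ∉ I else k ∈ I, fun k => by simp⟩
  have hKi : i ∈ K ↔ i ∉ I := by rw [hK, if_pos rfl]
  have hKn : ∀ k, k ≠ i → (k ∈ K ↔ k ∈ I) := fun k hk => by rw [hK, if_neg hk]
  have hIK := fun {n : ℕ} (hn : n ≤ m) => prefixProd_toggle cs Q hKn hKi hn
  have hJK := prefixProd_toggle cs Q (I := K) (J := J) (i := j) (fun k hkj => by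
    by_cases hki : k = i
    · subst hki; rw [hi, hKi]
    · rw [h k hki hkj, hKn k hki]) (by rw [hj, hKn j hij.symm]) hk
  have hinv : (rootRefl cs Q I i)⁻¹ = rootRefl cs Q I i :=
    inv_eq_of_mul_eq_one_left (rootRefl_mul_self cs Q I i)
  have hjK : rootRefl cs Q K j =
      if i < j then rootRefl cs Q I i * rootRefl cs Q I j * rootRefl cs Q I i
        else rootRefl cs Q I j := by
    rw [rootRefl, hIK j.2.le]
    simp only [← Fin.lt_def]
    split_ifs
    · rw [mul_inv_rev, hinv]
      conv_rhs => rw [rootRefl.eq_def cs Q I j]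
      simp only [mul_assoc]
    · rfl
  rw [hJK, hIK hk, hjK]
  split_ifs <;> simp [mul_assoc]

theorem prefixProd_toggle_two_of_eq {I J : Finset (Fin m)} {i j : Fin m} (hij : i ≠ j)
    (h : ∀ k, k ≠ i → k ≠ j → (k ∈ J ↔ k ∈ I)) (hi : i ∈ J ↔ i ∉ I) (hj : j ∈ J ↔ j ∉ I)
    (ht : rootRefl cs Q I i = rootRefl cs Q I j) {k : ℕ} (hk : k ≤ m) :
    prefixProd cs Q J k =
      if ((i : ℕ) < k ↔ (j : ℕ) < k) then prefixProd cs Q I k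
      else rootRefl cs Q I i * prefixProd cs Q I k := by
  have hs := rootRefl_mul_self cs Q I i
  rw [prefixProd_toggle_two cs Q hij h hi hj hk, ← ht, hs, one_mul, ite_self]
  by_cases h1 : (i : ℕ) < k <;> by_cases h2 : (j : ℕ) < k <;> simp [h1, h2, hs]

theorem rootRefl_eq_of_prefixProd_eq {I J : Finset (Fin m)} {i j : Fin m} (hij : i ≠ j)
    (h : ∀ k, k ≠ i → k ≠ j → (k ∈ J ↔ k ∈ I)) (hi : i ∈ J ↔ i ∉ I) (hj : j ∈ J ↔ j ∉ I)
    (hm : prefixProd cs Q J m = prefixProd cs Q I m) :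
    rootRefl cs Q I i = rootRefl cs Q I j := by
  have h1 := prefixProd_toggle_two cs Q hij h hi hj le_rfl
  rw [hm, if_pos j.2, if_pos i.2, right_eq_mul] at h1
  have hsi := rootRefl_mul_self cs Q I i
  have hsj := rootRefl_mul_self cs Q I j
  split_ifs at h1
  · rw [mul_assoc, hsi, mul_one] at h1
    rw [eq_inv_of_mul_eq_one_left h1, inv_eq_of_mul_eq_one_left hsj]
  · rw [eq_inv_of_mul_eq_one_right h1, inv_eq_of_mul_eq_one_left hsj]

variable {Q} {cs}

theorem root_nonneg_mul_simple_iff {w u : W} {s q : B}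
    (h : u * cs.simple q * u⁻¹ = w * cs.simple s * w⁻¹) :
    0 ≤ root C cs ((w * cs.simple s)⁻¹ * u) q ↔ ¬ 0 ≤ root C cs (w⁻¹ * u) q := by
  have : (w * cs.simple s)⁻¹ * u = w⁻¹ * u * cs.simple q := by
    rw [mul_inv_rev, cs.inv_simple]
    calc cs.simple s * w⁻¹ * u = w⁻¹ * (w * cs.simple s * w⁻¹) * u := by group
      _ = w⁻¹ * u * cs.simple q := by rw [← h]; group
  rw [this, root_mul_simple, not_root_nonneg_iff, neg_nonneg]

/-! ### Flips between facets -/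

section Facets

variable [Finite W]

/-- The reflections in the roots `r(I, k)` with `k ∉ I` are distinct. -/
theorem rootRefl_injOn_compl {I : Finset (Fin m)} (hI : Maximal (IsFace cs Q) I) {i j : Fin m}
    (hi : i ∉ I) (hj : j ∉ I) (h : rootRefl cs Q I i = rootRefl cs Q I j) : i = j := by
  classical
  by_contra hij
  -- If the reflections agreed, both letters could be deleted without changing the product, leaving
  -- a word for w_∘ shorter than its length.
  have hpre := prefixProd_toggle_two_of_eq cs Q (I := I) (J := insert i (insert j I)) hij
    (fun k h1 h2 => by simp [h1, h2]) (by simp [hi]) (by simp [hj]) h le_rfl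
  rw [if_pos (by simp)] at hpre
  have hc := (maximal_isFace_iff cs Q).1 hI
  have h1 := length_prefixProd_le cs Q (insert i (insert j I)) m
  rw [hpre, hc.1, ← hc.2, prefixCard_card] at h1
  have h2 : (insert i (insert j I))ᶜ ⊂ Iᶜ := by
    rw [Finset.compl_ssubset_compl, Finset.ssubset_iff_subset_ne]
    refine ⟨fun z hz => by simp [hz], fun he => hi ?_⟩
    rw [he]; simp
  have := Finset.card_lt_card h2
  omega

theorem flip_notMem {I J : Finset (Fin m)} {i j : Fin m} (hij : i ≠ j)
    (h : I.erase i = J.erase j) : j ∉ I := by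
  intro hjI
  have : j ∈ I.erase i := Finset.mem_erase.2 ⟨hij.symm, hjI⟩
  rw [h] at this
  simp at this

theorem flip_mem_iff {I J : Finset (Fin m)} {i j : Fin m}
    (h : I.erase i = J.erase j) (k : Fin m) (hki : k ≠ i) (hkj : k ≠ j) : k ∈ J ↔ k ∈ I := by
  have := Finset.ext_iff.1 h k
  simpa [hki, hkj] using this.symm

theorem rootRefl_eq_of_flip {I J : Finset (Fin m)} (hI : Maximal (IsFace cs Q) I)
    (hJ : Maximal (IsFace cs Q) J) {i j : Fin m} (hi : i ∈ I) (hj : j ∈ J) (hij : i ≠ j)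
    (h : I.erase i = J.erase j) : rootRefl cs Q I i = rootRefl cs Q I j := by
  have hjI := flip_notMem hij h
  have hiJ := flip_notMem hij.symm h.symm
  refine rootRefl_eq_of_prefixProd_eq cs Q hij (flip_mem_iff h) (by tauto) (by tauto) ?_
  rw [((maximal_isFace_iff cs Q).1 hI).1, ((maximal_isFace_iff cs Q).1 hJ).1]

theorem prefixProd_flip {I J : Finset (Fin m)} (hI : Maximal (IsFace cs Q) I)
    (hJ : Maximal (IsFace cs Q) J) {i j : Fin m} (hi : i ∈ I) (hj : j ∈ J) (hij : i ≠ j)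
    (h : I.erase i = J.erase j) {k : ℕ} (hk : k ≤ m) :
    prefixProd cs Q J k =
      if ((i : ℕ) < k ↔ (j : ℕ) < k) then prefixProd cs Q I k
      else rootRefl cs Q I i * prefixProd cs Q I k := by
  have hjI := flip_notMem hij h
  have hiJ := flip_notMem hij.symm h.symm
  exact prefixProd_toggle_two_of_eq cs Q hij (flip_mem_iff h) (by tauto) (by tauto)
    (rootRefl_eq_of_flip hI hJ hi hj hij h) hk

/-- The prefix at i either is unchanged or is multiplied by t_i, and t_i commutes with itself. -/
theorem rootRefl_flip {I J : Finset (Fin m)} (hI : Maximal (IsFace cs Q) I)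
    (hJ : Maximal (IsFace cs Q) J) {i j : Fin m} (hi : i ∈ I) (hj : j ∈ J) (hij : i ≠ j)
    (h : I.erase i = J.erase j) : rootRefl cs Q J j = rootRefl cs Q I i := by
  rw [rootRefl_eq_of_flip hJ hI hj hi hij.symm h.symm]
  have hpre := prefixProd_flip hI hJ hi hj hij h i.2.le
  rw [rootRefl, hpre]
  split_ifs
  · rfl
  · rw [rootRefl]; group

/-- A flip is increasing if and only if its root is positive. -/
theorem root_nonneg_iff_flip_lt {I J : Finset (Fin m)} (hI : Maximal (IsFace cs Q) I)
    (hJ : Maximal (IsFace cs Q) J) {i j : Fin m} (hi : i ∈ I) (hj : j ∈ J) (hij : i ≠ j)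
    (h : I.erase i = J.erase j) : 0 ≤ root C cs (prefixProd cs Q I i) (Q i) ↔ i < j := by
  have hiJ := flip_notMem hij.symm h.symm
  -- Position i is a letter of the reduced word of J, so r(J,i) is positive. It equals r(I,i) when i
  -- < j and -r(I,i) when j < i.
  have hpos := root_prefixProd_nonneg C hJ hiJ
  have hpre := prefixProd_flip hI hJ hi hj hij h i.2.le
  rw [hpre] at hpos
  simp only [lt_self_iff_false, false_iff, ← Fin.lt_def] at hpos
  by_cases hlt : i < j
  · rw [if_pos (not_lt.2 hlt.le)] at hpos
    exact iff_of_true hpos hlt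
  · rw [if_neg (not_not.2 (lt_of_le_of_ne (not_lt.1 hlt) hij.symm))] at hpos
    have : rootRefl cs Q I i * prefixProd cs Q I i = prefixProd cs Q I i * cs.simple (Q i) := by
      rw [rootRefl]; group
    rw [this, root_mul_simple, neg_nonneg] at hpos
    exact iff_of_false (fun h0 => root_ne_zero C cs _ _ (le_antisymm hpos h0)) hlt

/-- The reflection t_i also occurs at some j ∉ I, and toggling two positions with equal reflections
preserves the full product. -/
theorem exists_flip (C : GenCartanMatrix M) {I : Finset (Fin m)} (hI : Maximal (IsFace cs Q) I)
    {i : Fin m} (hi : i ∈ I) :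
    ∃ (J : Facet cs Q) (j : Fin m), j ∈ J.1 ∧ i ≠ j ∧ I.erase i = J.1.erase j := by
  classical
  obtain ⟨j, hj, ht⟩ := exists_rootRefl_eq C hI (prefixProd cs Q I i) (Q i)
  have hij : i ≠ j := by rintro rfl; exact hj hi
  have he : I.erase i = (insert j (I.erase i)).erase j := by
    rw [Finset.erase_insert]
    simp [hj]
  have hJ : Maximal (IsFace cs Q) (insert j (I.erase i)) := by
    rw [maximal_isFace_iff] at hI ⊢
    have hpre := prefixProd_toggle_two_of_eq cs Q hij (flip_mem_iff he) (by simp [hi, hij])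
      (by simp [hj]) ht.symm le_rfl
    rw [if_pos (by simp)] at hpre
    refine ⟨hpre.trans hI.1, ?_⟩
    rw [← hI.2, Finset.card_compl, Finset.card_compl, Finset.card_insert_of_notMem (by simp [hj]),
      Finset.card_erase_add_one hi]
  exact ⟨⟨_, hJ⟩, j, by simp, hij, he⟩

/-- The new position must carry the reflection t_i, and reflections outside I are distinct. -/
theorem flip_unique {I J K : Finset (Fin m)} (hI : Maximal (IsFace cs Q) I)
    (hJ : Maximal (IsFace cs Q) J) (hK : Maximal (IsFace cs Q) K) {i j k : Fin m} (hi : i ∈ I)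
    (hj : j ∈ J) (hk : k ∈ K) (hij : i ≠ j) (hik : i ≠ k)
    (h : I.erase i = J.erase j) (h' : I.erase i = K.erase k) : J = K := by
  have h1 := rootRefl_eq_of_flip hI hJ hi hj hij h
  have h2 := rootRefl_eq_of_flip hI hK hi hk hik h'
  have h3 := rootRefl_injOn_compl hI (flip_notMem hij h) (flip_notMem hik h')
    (h1.symm.trans h2)
  subst h3
  rw [← Finset.insert_erase hj, ← Finset.insert_erase hk, ← h, ← h']

/-! ### The facet `κ(w)` -/

theorem rootConfigIn_iff {I : Facet cs Q} {w : W} :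
    RootConfigIn C cs I w ↔ ∀ i ∈ I.1, 0 ≤ root C cs (w⁻¹ * prefixProd cs Q I.1 i) (Q i) := by
  refine forall₂_congr fun i hi => ?_
  rw [rootFn_eq_root]
  constructor
  · rintro ⟨v, ⟨-, hv⟩, hw⟩
    rw [← rep_root, ← hw]
    simp only [rep_inv_rep]
    exact hv
  · intro h
    exact ⟨root C cs (w⁻¹ * prefixProd cs Q I.1 i) (Q i), ⟨⟨_, _, rfl⟩, h⟩, by
      simp only [rep_root, mul_inv_cancel_left]⟩

/-- The positive systems w(Φ⁺) and ws(Φ⁺) differ only on the line of w(α_s). -/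
theorem root_nonneg_mul_simple {w u : W} {s q : B} (h : 0 ≤ root C cs (w⁻¹ * u) q)
    (hne : u * cs.simple q * u⁻¹ ≠ w * cs.simple s * w⁻¹) :
    0 ≤ root C cs ((w * cs.simple s)⁻¹ * u) q := by
  by_contra hcon
  rw [not_root_nonneg_iff, mul_inv_rev, cs.inv_simple, mul_assoc] at hcon
  apply hne
  rw [← conj_eq_simple_of_sign_change C cs h hcon]
  group

/-- Passing from `w` to `ws`, the facet stays the same or is flipped at the root `w(α_s)`. -/
theorem exists_rootConfigIn_mul_simple
    (hinj : ∀ I : Facet cs Q, Set.InjOn (rootRefl cs Q I.1) I.1)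
    {I : Facet cs Q} {w : W} (hI : RootConfigIn C cs I w) (s : B) :
    ∃ J : Facet cs Q, RootConfigIn C cs J (w * cs.simple s) ∧
      ((J = I ∧ ∀ i ∈ I.1, rootRefl cs Q I.1 i ≠ w * cs.simple s * w⁻¹) ∨
      ∃ i ∈ I.1, ∃ j ∈ J.1, i ≠ j ∧ I.1.erase i = J.1.erase j ∧
        rootRefl cs Q I.1 i = w * cs.simple s * w⁻¹) := by
  rw [rootConfigIn_iff] at hI
  by_cases hex : ∃ i ∈ I.1, rootRefl cs Q I.1 i = w * cs.simple s * w⁻¹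
  · obtain ⟨i, hi, ht⟩ := hex
    obtain ⟨J, j, hj, hij, he⟩ := exists_flip C I.2 hi
    refine ⟨J, ?_, Or.inr ⟨i, hi, j, hj, hij, he, ht⟩⟩
    rw [rootConfigIn_iff]
    intro k hk
    by_cases hkj : k = j
    · subst hkj
      have hJt := rootRefl_flip I.2 J.2 hi hj hij he
      rw [root_nonneg_mul_simple_iff C (hJt.trans ht)]
      -- r(J,j) and r(I,i) lie on one line with opposite signs, because the flip is increasing in
      -- exactly one direction. So r(J,j) lies on the side of ws.
      have h1 := root_nonneg_congr C cs hJt w⁻¹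
      rw [root_nonneg_iff_flip_lt C I.2 J.2 hi hj hij he,
        root_nonneg_iff_flip_lt C J.2 I.2 hj hi hij.symm he.symm] at h1
      have h2 := hI i hi
      have h3 : ¬ (k < i ↔ i < k) := by
        intro h
        rcases lt_or_gt_of_ne hij with hlt | hlt
        · exact lt_asymm hlt (h.2 hlt)
        · exact lt_asymm hlt (h.1 hlt)
      tauto
    · have hki : k ≠ i := by rintro rfl; exact flip_notMem hij.symm he.symm hk
      have hkI := (flip_mem_iff he k hki hkj).1 hk
      have hne : rootRefl cs Q I.1 k ≠ w * cs.simple s * w⁻¹ := by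
        intro h
        exact hki (hinj I hkI hi (h.trans ht.symm))
      have h0 := hI k hkI
      rw [prefixProd_flip I.2 J.2 hi hj hij he k.2.le]
      split_ifs
      · exact root_nonneg_mul_simple C h0 hne
      -- Between i and j the root is reflected by t_i = wsw⁻¹, which exactly compensates the passage
      -- from w to ws.
      · have : (w * cs.simple s)⁻¹ * (rootRefl cs Q I.1 i * prefixProd cs Q I.1 k) =
            w⁻¹ * prefixProd cs Q I.1 k := by rw [ht]; group
        rwa [this]
  · push Not at hex
    refine ⟨I, ?_, Or.inl ⟨rfl, hex⟩⟩
    rw [rootConfigIn_iff]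
    intro i hi
    exact root_nonneg_mul_simple C (hI i hi) (hex i hi)

/-- The step from w to ws is reversible: going back from any solution at ws lands on the unique
solution at w, and the flip there is unique. -/
theorem existsUnique_rootConfigIn_mul_simple
    (hinj : ∀ I : Facet cs Q, Set.InjOn (rootRefl cs Q I.1) I.1) {w : W} (s : B)
    (h : ∃! I : Facet cs Q, RootConfigIn C cs I w) :
    ∃! I : Facet cs Q, RootConfigIn C cs I (w * cs.simple s) := by
  obtain ⟨I, hI, huniq⟩ := h
  obtain ⟨J, hJ, hIJ⟩ := exists_rootConfigIn_mul_simple C hinj hI s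
  refine ⟨J, hJ, fun K hK => ?_⟩
  obtain ⟨I', hI', hKI⟩ := exists_rootConfigIn_mul_simple C hinj hK s
  rw [cs.simple_mul_simple_cancel_right] at hI'
  obtain rfl := huniq I' hI'
  have hconj : w * cs.simple s * cs.simple s * (w * cs.simple s)⁻¹ = w * cs.simple s * w⁻¹ := by
    rw [mul_inv_rev, cs.inv_simple, cs.simple_mul_simple_cancel_right, mul_assoc]
  rw [hconj] at hKI
  rcases hKI with ⟨rfl, hK'⟩ | ⟨k, hk, i', hi', hki, he, ht⟩
  · rcases hIJ with ⟨rfl, -⟩ | ⟨i, hi, j, hj, hij, he, ht⟩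
    · rfl
    · exact absurd ht (hK' i hi)
  · have ht' := (rootRefl_flip K.2 I'.2 hk hi' hki he).trans ht
    rcases hIJ with ⟨rfl, hJ'⟩ | ⟨i, hi, j, hj, hij, he', htt⟩
    · exact absurd ht' (hJ' i' hi')
    · obtain rfl := hinj I' hi' hi (ht'.trans htt.symm)
      exact Subtype.ext (flip_unique I'.2 K.2 J.2 hi' hk hj hki.symm hij he.symm he')

/-- The greedy facet, given by the Demazure product, is the only one whose root configuration
consists of negative roots. -/
theorem existsUnique_rootConfigIn_longest
    (hQ : demazure cs (List.ofFn Q) = longest cs) :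
    ∃! I : Facet cs Q, RootConfigIn C cs I (longest cs) := by
  -- Roots in I must be negative while roots outside I are positive. So I consists of the positions
  -- whose letter would not lengthen the prefix, and this rule determines I recursively.
  have hiff : ∀ I : Facet cs Q, RootConfigIn C cs I (longest cs) ↔
      ∀ k : Fin m, k ∈ I.1 ↔ ¬ cs.length (prefixProd cs Q I.1 k) <
        cs.length (prefixProd cs Q I.1 k * cs.simple (Q k)) := by
    intro I
    rw [rootConfigIn_iff]
    simp only [root_longest_inv_mul_nonneg_iff, ← root_nonneg_iff C cs, not_root_nonneg_iff]
    refine ⟨fun h k => ⟨h k, fun h1 => ?_⟩, fun h k => (h k).1⟩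
    by_contra hk
    exact root_ne_zero C cs _ _ (le_antisymm h1 (root_prefixProd_nonneg C I.2 hk))
  let d : ℕ → W := fun k => demazure cs ((List.ofFn Q).take k)
  have hd : ∀ k : Fin m, d (k + 1) = if cs.length (d k * cs.simple (Q k)) = cs.length (d k) + 1
      then d k * cs.simple (Q k) else d k := by
    intro k
    have : (List.ofFn Q).take (k + 1) = (List.ofFn Q).take k ++ [Q k] := by
      rw [List.take_add_one, List.getElem?_eq_getElem (by simp)]
      simp
    dsimp only [d]
    rw [this, demazure, List.foldl_append]
    rfl
  -- G is the set of letters skipped by the Demazure product, so its prefix products are the partial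
  -- Demazure products.
  let G : Finset (Fin m) :=
    Finset.univ.filter fun k => ¬ cs.length (d k * cs.simple (Q k)) = cs.length (d k) + 1
  have hG : ∀ k, k ≤ m → prefixProd cs Q G k = d k ∧ cs.length (d k) = prefixCard G k := by
    intro k hk
    induction k with
    | zero => simp [prefixProd_zero, d, demazure, prefixCard]
    | succ k ih =>
      obtain ⟨ih1, ih2⟩ := ih (by omega)
      obtain ⟨z, rfl⟩ : ∃ z : Fin m, (z : ℕ) = k := ⟨⟨k, by omega⟩, rfl⟩
      by_cases hz : cs.length (d z * cs.simple (Q z)) = cs.length (d z) + 1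
      · have hzG : z ∉ G := by simp [G, hz]
        rw [hd, if_pos hz, prefixProd_succ_of_notMem cs Q hzG, prefixCard_succ_of_notMem hzG, hz,
          ih1, ih2]
        exact ⟨rfl, rfl⟩
      · have hzG : z ∈ G := by simp [G, hz]
        rw [hd, if_neg hz, prefixProd_succ_of_mem cs Q hzG, prefixCard_succ_of_mem hzG]
        exact ⟨ih1, ih2⟩
  have hdm : d m = longest cs := by
    simp only [d]
    rw [List.take_of_length_le (by simp), hQ]
  have hGm := hG m le_rfl
  rw [hdm, prefixCard_card] at hGm
  have hGfacet : Maximal (IsFace cs Q) G := (maximal_isFace_iff cs Q).2 ⟨hGm.1, hGm.2.symm⟩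
  refine ⟨⟨G, hGfacet⟩, (hiff _).2 fun k => ?_, fun J hJ => ?_⟩
  · simp only [(hG k k.2.le).1]
    simp only [G, Finset.mem_filter, Finset.mem_univ, true_and]
    rcases cs.length_mul_simple (d k) (Q k) with h | h <;> omega
  · have hJ' := (hiff J).1 hJ
    have hpre : ∀ k, k ≤ m → prefixProd cs Q J.1 k = d k := by
      intro k hk
      induction k with
      | zero => simp [prefixProd_zero, d, demazure]
      | succ k ih =>
        have ih := ih (by omega)
        obtain ⟨z, rfl⟩ : ∃ z : Fin m, (z : ℕ) = k := ⟨⟨k, by omega⟩, rfl⟩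
        have hz := hJ' z
        rw [ih] at hz
        rcases cs.length_mul_simple (d z) (Q z) with h | h
        · have hzJ : z ∉ J.1 := by rw [hz]; omega
          rw [hd, if_pos h, prefixProd_succ_of_notMem cs Q hzJ, ih]
        · have hzJ : z ∈ J.1 := by rw [hz]; omega
          rw [hd, if_neg (by omega), prefixProd_succ_of_mem cs Q hzJ, ih]
    apply Subtype.ext
    ext k
    rw [hJ', hpre k k.2.le]
    simp only [G, Finset.mem_filter, Finset.mem_univ, true_and]
    rcases cs.length_mul_simple (d k) (Q k) with h | h <;> omega

/-- For every `w` there is a unique facet with root configuration in `w(Φ⁺)`. -/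
theorem existsUnique_rootConfigIn
    (hinj : ∀ I : Facet cs Q, Set.InjOn (rootRefl cs Q I.1) I.1)
    (hQ : demazure cs (List.ofFn Q) = longest cs) (w : W) :
    ∃! I : Facet cs Q, RootConfigIn C cs I w := by
  have h : ∀ x : W, ∃! I : Facet cs Q, RootConfigIn C cs I (longest cs * x) := by
    intro x
    induction x using cs.simple_induction_right with
    | one => rw [mul_one]; exact existsUnique_rootConfigIn_longest C hQ
    | mul_simple_right x s ih =>
      rw [← mul_assoc]
      exact existsUnique_rootConfigIn_mul_simple C hinj s ih
  have := h ((longest cs)⁻¹ * w)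
  rwa [mul_inv_cancel_left] at this

/-- Equal reflections would have proportional roots, contradicting linear independence. -/
theorem rootRefl_injOn_of_isRealizing (hreal : IsRealizing C cs Q) (I : Facet cs Q) :
    Set.InjOn (rootRefl cs Q I.1) I.1 := by
  intro i hi j hj h
  obtain ⟨c, -, hc⟩ := root_eq_smul_of_conj_simple_eq C cs h
  have := (hreal I).1.eq_of_smul_apply_eq_smul_apply (i := ⟨i, hi⟩) (j := ⟨j, hj⟩) 1 c
    one_ne_zero (by rw [one_smul]; exact hc)
  exact congrArg Subtype.val this

end Facets

end BrickQuotient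

namespace BrickQuotient

open GenCartanMatrix

/-! ### Chambers of generic total orders -/

section Lex

variable {V : Type*} [AddCommGroup V] [Module ℝ V]

/-- The lexicographic order of the coordinates in a basis, the `i`-th coordinate being the last. -/
theorem exists_lex_pos {ι : Type*} [Finite ι] (b : Module.Basis ι ℝ V) (i : ι) :
    ∃ P : V → Prop, (∀ x y, P x → P y → P (x + y)) ∧ (∀ (c : ℝ) x, 0 < c → P x → P (c • x)) ∧
      (∀ x, x ≠ 0 → P x ∨ P (-x)) ∧ ¬ P 0 ∧ (∀ k, P (b k)) ∧
      (∀ x, P x → (b i - x = 0 ∨ P (b i - x)) → ∃ c : ℝ, x = c • b i) := by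
  classical
  -- f ranks the coordinates; i receives rank n, above all the ranks e k < n.
  obtain ⟨f, hf, hfi⟩ : ∃ f : ι → ℕ, Function.Injective f ∧ ∀ k, f k ≤ f i := by
    obtain ⟨n, ⟨e⟩⟩ := Finite.exists_equiv_fin ι
    refine ⟨fun k => if k = i then n else e k, fun k l h => ?_, fun k => ?_⟩
    · have hk := (e k).2
      have hl := (e l).2
      dsimp only at h
      split_ifs at h with h1 h2 h2
      · rw [h1, h2]
      · omega
      · omega
      · exact e.injective (Fin.ext h)
    · have hk := (e k).2
      dsimp only
      rw [if_pos rfl]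
      split_ifs <;> omega
  have hlt : ∀ k, k ≠ i → f k < f i := fun k hk => lt_of_le_of_ne (hfi k) fun h => hk (hf h)
  refine ⟨fun x => ∃ k, 0 < b.repr x k ∧ ∀ l, f l < f k → b.repr x l = 0, ?_, ?_, ?_, ?_, ?_, ?_⟩
  · rintro x y ⟨k, hk, hk'⟩ ⟨l, hl, hl'⟩
    rcases lt_trichotomy (f k) (f l) with h | h | h
    · refine ⟨k, ?_, fun j hj => ?_⟩
      · rw [map_add, Finsupp.add_apply, hl' k h, add_zero]; exact hk
      · rw [map_add, Finsupp.add_apply, hk' j hj, hl' j (hj.trans h), add_zero]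
    · obtain rfl := hf h
      refine ⟨k, ?_, fun j hj => ?_⟩
      · rw [map_add, Finsupp.add_apply]; exact add_pos hk hl
      · rw [map_add, Finsupp.add_apply, hk' j hj, hl' j hj, add_zero]
    · refine ⟨l, ?_, fun j hj => ?_⟩
      · rw [map_add, Finsupp.add_apply, hk' l h, zero_add]; exact hl
      · rw [map_add, Finsupp.add_apply, hk' j (hj.trans h), hl' j hj, add_zero]
  · rintro c x hc ⟨k, hk, hk'⟩
    refine ⟨k, ?_, fun j hj => ?_⟩
    · rw [map_smul, Finsupp.smul_apply]; exact mul_pos hc hk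
    · rw [map_smul, Finsupp.smul_apply, hk' j hj, smul_zero]
  · intro x hx
    have hne : ∃ n, ∃ k, f k = n ∧ b.repr x k ≠ 0 := by
      by_contra! hcon
      apply hx
      apply b.repr.injective
      ext k
      rw [hcon _ k rfl]
      simp
    obtain ⟨k, hk, hk0⟩ := Nat.find_spec hne
    have hmin : ∀ l, f l < f k → b.repr x l = 0 := by
      intro l hl
      rw [hk] at hl
      by_contra h
      exact Nat.find_min hne hl ⟨l, rfl, h⟩
    rcases lt_or_gt_of_ne hk0 with h | h
    · refine Or.inr ⟨k, ?_, fun l hl => ?_⟩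
      · rw [map_neg, Finsupp.neg_apply]; linarith
      · rw [map_neg, Finsupp.neg_apply, hmin l hl, neg_zero]
    · exact Or.inl ⟨k, h, hmin⟩
  · rintro ⟨k, hk, -⟩
    simp at hk
  · intro k
    refine ⟨k, by simp, fun l hl => ?_⟩
    have : k ≠ l := by rintro rfl; exact lt_irrefl _ hl
    simp [this]
  · rintro x ⟨k, hk, hk'⟩ h
    -- A leading coordinate of x ranked before i would make b i - x negative. So x has no coordinate
    -- other than the i-th.
    have hki : k = i := by
      by_contra hki
      have hyl : ∀ l, f l ≤ f k → b.repr (b i - x) l = - b.repr x l := by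
        intro l hl
        have : i ≠ l := by rintro rfl; exact absurd (hlt k hki) (not_lt.2 hl)
        simp [this]
      rcases h with h | ⟨l, hl, hl'⟩
      · have := hyl k le_rfl
        rw [h] at this
        simp only [map_zero, Finsupp.coe_zero, Pi.zero_apply] at this
        linarith
      · rcases lt_trichotomy (f l) (f k) with h1 | h1 | h1
        · rw [hyl l h1.le, hk' l h1] at hl; simp at hl
        · obtain rfl := hf h1
          rw [hyl l le_rfl] at hl; linarith
        · have := hl' k h1
          rw [hyl k le_rfl] at this; linarith
    subst hki
    refine ⟨b.repr x k, ?_⟩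
    apply b.repr.injective
    ext l
    by_cases hl : k = l
    · subst hl; simp
    · rw [hk' l (hlt l (Ne.symm hl))]; simp [hl]

end Lex

variable {B : Type*} {W : Type*} [Group W] [Finite W] {M : CoxeterMatrix B}
variable (C : GenCartanMatrix M) (cs : CoxeterSystem M W)

/-- Every generic total order on `V` is positive on the simple roots of some chamber. -/
theorem exists_chamber {P : (B →₀ ℝ) → Prop}
    (hsmul : ∀ (c : ℝ) x, 0 < c → P x → P (c • x)) (htri : ∀ x, x ≠ 0 → P x ∨ P (-x)) :
    ∃ w : W, ∀ s, P (root C cs w s) := by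
  have : Finite B := Finite.of_injective _ (simple_injective cs C)
  -- Minimize the number of positive roots that w sends to the wrong side of P. If w(α_s) were on
  -- the wrong side, (u, q) ↦ (su, q) would embed the bad pairs of ws into those of w, missing (1,
  -- s).
  let bad : W → Set (W × B) := fun w =>
    {p | 0 ≤ root C cs p.1 p.2 ∧ ¬ P (root C cs (w * p.1) p.2)}
  obtain ⟨w, hw⟩ := Finite.exists_min fun w => (bad w).ncard
  refine ⟨w, fun s => ?_⟩
  by_contra hs
  have hneg : P (-root C cs w s) := (htri _ (root_ne_zero C cs w s)).resolve_left hs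
  let g : W × B → W × B := fun p => (cs.simple s * p.1, p.2)
  have hg : Function.Injective g := by
    rintro ⟨u, q⟩ ⟨v, r⟩ h
    simpa [g] using h
  have hsub : g '' bad (w * cs.simple s) ⊂ bad w := by
    refine Set.ssubset_iff_of_subset ?_ |>.2 ⟨(1, s), ⟨?_, ?_⟩, ?_⟩
    · rintro _ ⟨⟨u, q⟩, ⟨h1, h2⟩, rfl⟩
      simp only at h1 h2
      refine ⟨?_, by simpa only [g, ← mul_assoc] using h2⟩
      by_contra h3
      have h4 := conj_eq_simple_of_sign_change C cs h1 ((not_root_nonneg_iff C cs).1 h3)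
      obtain ⟨c, hc, h5⟩ := root_eq_smul_of_conj_simple_eq C cs (u := u) (s := q) (v := 1) (t := s)
        (by rw [h4]; simp)
      have hc0 : 0 ≤ c := by
        have := h1 s
        rw [h5, root_one] at this
        simpa [simpleRoot] using this
      apply h2
      rw [← rep_root, h5, map_smul, rep_root, mul_one, root_mul_simple]
      exact hsmul _ _ (lt_of_le_of_ne hc0 hc.symm) hneg
    · simp only [root_one]; exact simpleRoot_nonneg s
    · simpa using hs
    · rintro ⟨⟨u, q⟩, ⟨h1, -⟩, h2⟩
      simp only [g, Prod.mk.injEq] at h2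
      obtain ⟨h2, rfl⟩ := h2
      have : u = 1 * cs.simple q := by
        rw [one_mul, ← cs.inv_simple]; exact eq_inv_of_mul_eq_one_right h2
      simp only [this, root_mul_simple, root_one] at h1
      exact simpleRoot_ne_zero q (le_antisymm (neg_nonneg.1 h1) (simpleRoot_nonneg q))
  have h1 := Set.ncard_lt_ncard hsub (Set.toFinite _)
  rw [Set.ncard_image_of_injective _ hg] at h1
  exact absurd (hw (w * cs.simple s)) (not_le.2 h1)

/-! ### Surjectivity of κ and lifting of flips to covers -/

variable {cs} {m : ℕ} {Q : Fin m → B}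

/-- For each `i ∈ I`, the root `r(I, i)` is a simple root of some `w(Φ⁺)` that contains the root
configuration of `I`. -/
theorem exists_rootConfigIn_of_mem (hreal : IsRealizing C cs Q) (I : Facet cs Q) {i : Fin m}
    (hi : i ∈ I.1) :
    ∃ (w : W) (s : B), RootConfigIn C cs I w ∧ rootRefl cs Q I.1 i = w * cs.simple s * w⁻¹ ∧
      (0 ≤ root C cs (prefixProd cs Q I.1 i) (Q i) → 0 ≤ root C cs w s) := by
  let b := Module.Basis.mk (hreal I).1 (hreal I).2.ge
  have hb : ∀ k : {k // k ∈ I.1}, b k = root C cs (prefixProd cs Q I.1 k.1) (Q k.1) := by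
    intro k
    rw [Module.Basis.mk_apply, rootFn_eq_root]
  obtain ⟨P, hadd, hsmul, htri, h0, hPb, hmin⟩ := exists_lex_pos b ⟨i, hi⟩
  obtain ⟨w, hw⟩ := exists_chamber C cs hsmul htri
  have hcone : ∀ x : B →₀ ℝ, 0 ≤ x → C.rep cs w x = 0 ∨ P (C.rep cs w x) := by
    intro x hx
    rw [← Finsupp.sum_single x, Finsupp.sum, map_sum]
    refine Finset.sum_induction _ (fun y => y = 0 ∨ P y) ?_ (Or.inl rfl) fun s hs => ?_
    · rintro y z (rfl | hy) (rfl | hz)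
      · simp
      · rw [zero_add]; exact Or.inr hz
      · rw [add_zero]; exact Or.inr hy
      · exact Or.inr (hadd _ _ hy hz)
    · have : (Finsupp.single s (x s) : B →₀ ℝ) = x s • simpleRoot s := by simp [simpleRoot]
      rw [this, map_smul]
      exact Or.inr (hsmul _ _ (lt_of_le_of_ne (hx s) (Finsupp.mem_support_iff.1 hs).symm) (hw s))
  have hRC : ∀ k ∈ I.1, 0 ≤ root C cs (w⁻¹ * prefixProd cs Q I.1 k) (Q k) := by
    intro k hk
    by_contra hcon
    have h1 := hcone _ (neg_nonneg.2 ((not_root_nonneg_iff C cs).1 hcon))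
    rw [map_neg, rep_root, mul_inv_cancel_left, neg_eq_zero] at h1
    have h2 := h1.resolve_left (root_ne_zero C cs _ _)
    have h3 := hPb ⟨k, hk⟩
    rw [hb] at h3
    have := hadd _ _ h3 h2
    rw [add_neg_cancel] at this
    exact h0 this
  have hPi := hPb ⟨i, hi⟩
  rw [hb] at hPi hmin
  set r := root C cs (prefixProd cs Q I.1 i) (Q i) with hr
  set c := root C cs (w⁻¹ * prefixProd cs Q I.1 i) (Q i) with hc
  have hc0 : 0 ≤ c := hRC i hi
  have hcr : C.rep cs w c = r := by rw [hc, rep_root, mul_inv_cancel_left]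
  obtain ⟨s, hs⟩ : ∃ s, c s ≠ 0 := by
    by_contra! hcon
    exact root_ne_zero C cs _ _ (Finsupp.ext hcon)
  have hs0 : 0 < c s := lt_of_le_of_ne (hc0 s) hs.symm
  -- r is a non-negative combination of the roots w(α_t). Since r is last in the lexicographic
  -- order, a positive summand with zero or positive remainder must be a multiple of r.
  obtain ⟨d, hd⟩ := hmin (c s • root C cs w s) (hsmul _ _ hs0 (hw s)) (by
    have h1 := hcone (c - Finsupp.single s (c s)) (by
      classical
      intro t
      rw [Finsupp.sub_apply, Finsupp.single_apply]
      split_ifs with hst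
      · rw [hst]; simp
      · simpa using hc0 t)
    have : (Finsupp.single s (c s) : B →₀ ℝ) = c s • simpleRoot s := by simp [simpleRoot]
    rw [map_sub, hcr, this, map_smul] at h1
    exact h1)
  have hd' : root C cs w s = ((c s)⁻¹ * d) • r := by
    rw [← smul_smul, ← hd, inv_smul_smul₀ hs]
  refine ⟨w, s, (rootConfigIn_iff C).2 hRC, (conj_simple_eq_of_root_eq C cs hd').symm, fun hr0 => ?_⟩
  rw [hd']
  refine smul_nonneg ?_ hr0
  -- Both r and w(α_s) are positive for P, so the factor between them cannot be negative.
  by_contra! hneg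
  have h1 := hsmul _ _ (neg_pos.2 hneg) hPi
  rw [neg_smul, ← hd'] at h1
  have := hadd _ _ (hw s) h1
  rw [add_neg_cancel] at this
  exact h0 this

theorem exists_rootConfigIn (hreal : IsRealizing C cs Q) (I : Facet cs Q) :
    ∃ w : W, RootConfigIn C cs I w := by
  rcases I.1.eq_empty_or_nonempty with h | ⟨i, hi⟩
  · exact ⟨1, fun i hi => by simp [h] at hi⟩
  · obtain ⟨w, -, hw, -⟩ := exists_rootConfigIn_of_mem C hreal I hi
    exact ⟨w, hw⟩

/-- An increasing flip is the image of a cover relation of the weak order. -/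
theorem exists_cover_of_increasingFlip (hreal : IsRealizing C cs Q) {I J : Facet cs Q}
    (h : IncreasingFlip I J) :
    ∃ (w : W) (s : B), cs.length w < cs.length (w * cs.simple s) ∧ RootConfigIn C cs I w ∧
      RootConfigIn C cs J (w * cs.simple s) := by
  obtain ⟨i, hi, j, hj, hij, he⟩ := h
  obtain ⟨w, s, hw, ht, hpos⟩ := exists_rootConfigIn_of_mem C hreal I hi
  refine ⟨w, s, ?_, hw, ?_⟩
  · rw [← root_nonneg_iff C]
    exact hpos ((root_nonneg_iff_flip_lt C I.2 J.2 hi hj hij.ne he).2 hij)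
  · have hinj := rootRefl_injOn_of_isRealizing C hreal
    obtain ⟨K, hK, ⟨-, hne⟩ | ⟨i', hi', k, hk, hik, he', ht'⟩⟩ :=
      exists_rootConfigIn_mul_simple C hinj hw s
    · exact absurd ht (hne i hi)
    · obtain rfl := hinj I hi hi' (ht.trans ht'.symm)
      rwa [Subtype.ext (flip_unique I.2 J.2 K.2 hi hj hk hij.ne hik he he')]

/-- A cover relation of the weak order is mapped to an equality or to an increasing flip. -/
theorem eq_or_increasingFlip_of_cover (hreal : IsRealizing C cs Q) {I J : Facet cs Q} {w : W} {s : B}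
    (hs : cs.length w < cs.length (w * cs.simple s)) (hI : RootConfigIn C cs I w)
    (hJ : RootConfigIn C cs J (w * cs.simple s))
    (huniq : ∀ K : Facet cs Q, RootConfigIn C cs K (w * cs.simple s) → K = J) :
    I = J ∨ IncreasingFlip I J := by
  have hinj := rootRefl_injOn_of_isRealizing C hreal
  obtain ⟨K, hK, hIK⟩ := exists_rootConfigIn_mul_simple C hinj hI s
  obtain rfl := huniq K hK
  rcases hIK with ⟨rfl, -⟩ | ⟨i, hi, j, hj, hij, he, ht⟩
  · exact Or.inl rfl
  · refine Or.inr ⟨i, hi, j, hj, ?_, he⟩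
    rw [← root_nonneg_iff_flip_lt C I.2 K.2 hi hj hij he]
    have h1 := (rootConfigIn_iff C).1 hI i hi
    have h2 := root_nonneg_congr C cs ht w⁻¹
    have h3 : 0 ≤ root C cs (w⁻¹ * w) s := by
      rw [inv_mul_cancel, root_one]; exact simpleRoot_nonneg s
    have h4 := (root_nonneg_iff C cs).2 hs
    tauto

end BrickQuotient

namespace BrickQuotient

/-! ### The weak order -/

section Weak

variable {B : Type*} {W : Type*} [Group W] {M : CoxeterMatrix B} (cs : CoxeterSystem M W)

theorem WeakLE.length_le {u w : W} (h : WeakLE cs u w) : cs.length u ≤ cs.length w := by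
  obtain ⟨v, -, hv⟩ := h
  omega

theorem WeakLE.eq_of_length_le {u w : W} (h : WeakLE cs u w) (hl : cs.length w ≤ cs.length u) :
    u = w := by
  obtain ⟨v, rfl, hv⟩ := h
  have : cs.length v = 0 := by omega
  rw [cs.length_eq_zero_iff] at this
  rw [this, mul_one]

theorem WeakLE.exists_simple {u w : W} (h : WeakLE cs u w) (hne : u ≠ w) :
    ∃ s, cs.length u < cs.length (u * cs.simple s) ∧ WeakLE cs (u * cs.simple s) w := by
  obtain ⟨v, rfl, hv⟩ := h
  have hv1 : v ≠ 1 := by rintro rfl; simp at hne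
  obtain ⟨s, hs⟩ := cs.exists_leftDescent_of_ne_one hv1
  rw [cs.isLeftDescent_iff] at hs
  have hw : u * cs.simple s * (cs.simple s * v) = u * v := by
    rw [mul_assoc, cs.simple_mul_simple_cancel_left]
  have h1 := cs.length_mul_le (u * cs.simple s) (cs.simple s * v)
  rw [hw] at h1
  have h2 := cs.length_mul_simple u s
  exact ⟨s, by omega, cs.simple s * v, hw, by omega⟩

theorem weakLE_mul_simple {u : W} {s : B} (h : cs.length u < cs.length (u * cs.simple s)) :
    WeakLE cs u (u * cs.simple s) := by
  refine ⟨cs.simple s, rfl, ?_⟩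
  rw [cs.length_simple]
  have := cs.length_mul_simple u s
  omega

theorem coveredBy_weakLT_iff {u w : W} :
    CoveredBy (WeakLT cs) u w ↔
      ∃ s, cs.length u < cs.length (u * cs.simple s) ∧ u * cs.simple s = w := by
  constructor
  · rintro ⟨⟨h1, h2⟩, h3⟩
    obtain ⟨s, hs, hw⟩ := h1.exists_simple cs h2
    refine ⟨s, hs, ?_⟩
    by_contra hne
    exact h3 (u * cs.simple s) ⟨⟨weakLE_mul_simple cs hs, fun h => by rw [← h] at hs; omega⟩, hw, hne⟩
  · rintro ⟨s, hs, rfl⟩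
    refine ⟨⟨weakLE_mul_simple cs hs, fun h => by rw [← h] at hs; omega⟩, ?_⟩
    rintro z ⟨⟨h1, h2⟩, h3, h4⟩
    have h5 := mt (h1.eq_of_length_le cs) h2
    have h6 := mt (h3.eq_of_length_le cs) h4
    have := cs.length_mul_simple u s
    omega

theorem WeakLE.induction {R : W → W → Prop} (hrefl : ∀ u, R u u)
    (hstep : ∀ u s w, cs.length u < cs.length (u * cs.simple s) → R (u * cs.simple s) w → R u w)
    {u w : W} (h : WeakLE cs u w) : R u w := by
  induction hn : cs.length w - cs.length u using Nat.strong_induction_on generalizing u with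
  | _ n ih =>
  by_cases hne : u = w
  · rw [hne]; exact hrefl w
  · obtain ⟨s, hs, hw⟩ := h.exists_simple cs hne
    have := hw.length_le
    exact hstep u s w hs (ih _ (by omega) hw rfl)

end Weak

/-! ### The increasing flip order -/

section Count

variable {m : ℕ}

/-- The number of elements of `I` smaller than `p`. -/
def countLT (I : Finset (Fin m)) (p : ℕ) : ℕ := (I.filter fun z : Fin m => (z : ℕ) < p).card

theorem countLT_erase {I : Finset (Fin m)} {i : Fin m} (hi : i ∈ I) (p : ℕ) :
    countLT I p = countLT (I.erase i) p + if (i : ℕ) < p then 1 else 0 := by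
  unfold countLT
  rw [Finset.filter_erase]
  split_ifs with h
  · rw [Finset.card_erase_add_one (Finset.mem_filter.2 ⟨hi, h⟩)]
  · rw [Finset.erase_eq_of_notMem (by simp [h]), add_zero]

theorem countLT_succ (I : Finset (Fin m)) (z : Fin m) :
    countLT I (z + 1) = countLT I z + if z ∈ I then 1 else 0 := by
  unfold countLT
  split_ifs with h
  · rw [← Finset.card_insert_of_notMem (s := I.filter fun x : Fin m => (x : ℕ) < z) (a := z) (by simp)]
    congr 1
    ext x
    simp only [Finset.mem_filter, Finset.mem_insert, Fin.ext_iff]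
    constructor
    · rintro ⟨h1, h2⟩
      by_cases hx : (x : ℕ) = z
      · exact Or.inl hx
      · exact Or.inr ⟨h1, by omega⟩
    · rintro (h1 | ⟨h1, h2⟩)
      · exact ⟨by rwa [Fin.ext h1], by omega⟩
      · exact ⟨h1, by omega⟩
  · rw [add_zero]
    congr 1
    ext x
    simp only [Finset.mem_filter]
    refine and_congr_right fun hx => ?_
    have : (x : ℕ) ≠ z := fun he => h (by rwa [← Fin.ext he])
    omega

theorem mem_iff_of_countLT_eq {I J : Finset (Fin m)} {z : Fin m} (h : countLT I z = countLT J z)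
    (h' : countLT I (z + 1) = countLT J (z + 1)) : z ∈ I ↔ z ∈ J := by
  rw [countLT_succ, countLT_succ, h] at h'
  by_cases h1 : z ∈ I <;> by_cases h2 : z ∈ J <;> simp [h1, h2] at h' ⊢

end Count

variable {B : Type*} {W : Type*} [Group W] [Finite W] {M : CoxeterMatrix B}
variable {cs : CoxeterSystem M W} {m : ℕ} {Q : Fin m → B}

theorem flipLE_iff {I J : Facet cs Q} : FlipLE I J ↔ Relation.ReflTransGen IncreasingFlip I J := by
  rw [Relation.reflTransGen_iff_eq_or_transGen, FlipLE, FlipLT, or_comm, eq_comm]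

theorem FlipLE.refl (I : Facet cs Q) : FlipLE I I := Or.inr rfl

theorem FlipLE.trans {I J K : Facet cs Q} (h : FlipLE I J) (h' : FlipLE J K) : FlipLE I K := by
  rw [flipLE_iff] at *
  exact h.trans h'

theorem countLT_flip {I J : Finset (Fin m)} {i j : Fin m} (hi : i ∈ I) (hj : j ∈ J)
    (h : I.erase i = J.erase j) (p : ℕ) :
    countLT I p + (if (j : ℕ) < p then 1 else 0) = countLT J p + if (i : ℕ) < p then 1 else 0 := by
  rw [countLT_erase hi, countLT_erase hj, h]
  omega

/-- An increasing flip moves one element to the right. Since the counts determine the facet, this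
monotonicity makes the flip order antisymmetric. -/
theorem countLT_le_of_flipLE {I J : Facet cs Q} (h : FlipLE I J) (p : ℕ) :
    countLT J.1 p ≤ countLT I.1 p := by
  rw [flipLE_iff] at h
  induction h with
  | refl => exact le_rfl
  | tail _ h ih =>
    obtain ⟨i, hi, j, hj, hij, he⟩ := h
    refine le_trans ?_ ih
    have := countLT_flip hi hj he p
    have hij' : (i : ℕ) < j := hij
    split_ifs at this <;> omega

theorem eq_of_countLT_eq {I J : Facet cs Q} (h : ∀ p, countLT I.1 p = countLT J.1 p) : I = J := by
  apply Subtype.ext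
  ext z
  exact mem_iff_of_countLT_eq (h _) (h _)

theorem FlipLE.antisymm {I J : Facet cs Q} (h : FlipLE I J) (h' : FlipLE J I) : I = J :=
  eq_of_countLT_eq fun p => le_antisymm (countLT_le_of_flipLE h' p) (countLT_le_of_flipLE h p)

theorem IncreasingFlip.ne {I J : Facet cs Q} (h : IncreasingFlip I J) : I ≠ J := by
  rintro rfl
  obtain ⟨i, hi, j, hj, hij, he⟩ := h
  exact flip_notMem hij.ne he hj

theorem not_flipLT_self (I : Facet cs Q) : ¬ FlipLT I I := by
  intro h
  obtain ⟨J, h1, h2⟩ := Relation.TransGen.head'_iff.1 h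
  exact h1.ne (FlipLE.antisymm (Or.inl (Relation.TransGen.single h1)) (flipLE_iff.2 h2))

/-- A chain of increasing flips that removes `i` has a step that removes `i`. -/
theorem exists_increasingFlip_of_flipLT {I J : Facet cs Q} (h : FlipLT I J) {i : Fin m}
    (hi : i ∈ I.1) (hiJ : i ∉ J.1) :
    ∃ K L : Facet cs Q, FlipLE I K ∧ FlipLE L J ∧ i ∈ K.1 ∧
      ∃ x ∈ L.1, i < x ∧ K.1.erase i = L.1.erase x := by
  have hstep : ∀ K L : Facet cs Q, IncreasingFlip K L → i ∈ K.1 → i ∉ L.1 →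
      ∃ x ∈ L.1, i < x ∧ K.1.erase i = L.1.erase x := by
    rintro K L ⟨i', hi', x, hx, hlt, he⟩ hK hL
    by_cases hii : i = i'
    · subst hii; exact ⟨x, hx, hlt, he⟩
    · have h1 : i ∈ K.1.erase i' := Finset.mem_erase.2 ⟨hii, hK⟩
      rw [he] at h1
      exact absurd (Finset.mem_of_mem_erase h1) hL
  induction h with
  | single h => exact ⟨I, _, FlipLE.refl I, FlipLE.refl _, hi, hstep _ _ h hi hiJ⟩
  | @tail K L hIK hKL ih =>
    by_cases hK : i ∈ K.1
    · exact ⟨K, L, Or.inl hIK, FlipLE.refl L, hK, hstep _ _ hKL hK hiJ⟩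
    · obtain ⟨K', L', h1, h2, h3⟩ := ih hK
      exact ⟨K', L', h1, h2.trans (Or.inl (Relation.TransGen.single hKL)), h3⟩

/-- A flip that removes `i`, between the two ends of an increasing flip that removes `i`,
is that flip. -/
theorem eq_of_flip_between {I J K L : Facet cs Q}
    (hinj : Set.InjOn (rootRefl cs Q I.1) I.1) {i j x : Fin m} (hi : i ∈ I.1) (hj : j ∈ J.1)
    (hij : i < j) (he : I.1.erase i = J.1.erase j) (hK : i ∈ K.1) (hx : x ∈ L.1) (hix : i < x)
    (he' : K.1.erase i = L.1.erase x) (hIK : FlipLE I K) (hLJ : FlipLE L J) : I = K ∧ L = J := by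
  have h1 := countLT_flip hi hj he
  have h2 := countLT_flip hK hx he'
  have h3 := countLT_le_of_flipLE hIK
  have h4 := countLT_le_of_flipLE hLJ
  have hij' : (i : ℕ) < j := hij
  have hix' : (i : ℕ) < x := hix
  -- If j < x, the flip from I to J would preserve the count to the left of x while the one from K
  -- to L lowers it, contradicting monotonicity.
  have hxj : (x : ℕ) ≤ j := by
    by_contra hcon
    have h1 := h1 x
    have h2 := h2 x
    have h3 := h3 x
    have h4 := h4 x
    split_ifs at h1 h2 <;> omega
  -- For p ≤ x ≤ j both flips lower the count by the same amount, so monotonicity squeezes the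
  -- counts of I and K together.
  have heq : ∀ p : ℕ, p ≤ x → countLT I.1 p = countLT K.1 p := by
    intro p hp
    have h1 := h1 p
    have h2 := h2 p
    have h3 := h3 p
    have h4 := h4 p
    split_ifs at h1 h2 <;> omega
  have hmem : ∀ z : Fin m, z < x → (z ∈ I.1 ↔ z ∈ K.1) := by
    intro z hz
    have hz' : (z : ℕ) < x := hz
    exact mem_iff_of_countLT_eq (heq _ hz'.le) (heq _ hz')
  -- I and K agree to the left of x, so the equality t_x = t_i, known for K, holds for I.
  -- Distinctness inside I gives x ∉ I, and distinctness outside I gives x = j.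
  have ht : rootRefl cs Q I.1 x = rootRefl cs Q I.1 i := by
    rw [rootRefl_congr cs Q hmem, rootRefl_congr cs Q fun z hz => hmem z (hz.trans hix)]
    exact (rootRefl_eq_of_flip K.2 L.2 hK hx hix.ne he').symm
  have htj := rootRefl_eq_of_flip I.2 J.2 hi hj hij.ne he
  have hxj' : x = j := by
    by_cases hxI : x ∈ I.1
    · exact absurd (hinj hxI hi ht) hix.ne'
    · exact rootRefl_injOn_compl I.2 hxI (flip_notMem hij.ne he) (ht.trans htj)
  subst hxj'
  refine ⟨eq_of_countLT_eq fun p => ?_, eq_of_countLT_eq fun p => ?_⟩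
  all_goals
    have h1 := h1 p
    have h2 := h2 p
    have h3 := h3 p
    have h4 := h4 p
    omega

/-- Increasing flips are cover relations of the increasing flip order. -/
theorem coveredBy_flipLT_iff (hinj : ∀ I : Facet cs Q, Set.InjOn (rootRefl cs Q I.1) I.1)
    {I J : Facet cs Q} : CoveredBy FlipLT I J ↔ IncreasingFlip I J := by
  constructor
  · rintro ⟨h1, h2⟩
    obtain ⟨K, hK, hKJ⟩ := Relation.TransGen.head'_iff.1 h1
    rcases flipLE_iff.2 hKJ with h | rfl
    · exact absurd ⟨Relation.TransGen.single hK, h⟩ (h2 K)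
    · exact hK
  · intro h
    refine ⟨Relation.TransGen.single h, ?_⟩
    rintro N ⟨hIN, hNJ⟩
    obtain ⟨i, hi, j, hj, hij, he⟩ := h
    have hiJ := flip_notMem hij.ne' he.symm
    -- A chain through N removes i either after N or before N. That step must be the flip from I to
    -- J, which collapses N to I or to J.
    by_cases hN : i ∈ N.1
    · obtain ⟨K, L, hNK, hLJ, hK, x, hx, hix, he'⟩ := exists_increasingFlip_of_flipLT hNJ hN hiJ
      have hIN' : FlipLE I N := Or.inl hIN
      obtain ⟨rfl, -⟩ := eq_of_flip_between (hinj I) hi hj hij he hK hx hix he'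
        (hIN'.trans hNK) hLJ
      exact not_flipLT_self _ (by simpa [hIN'.antisymm hNK] using hIN)
    · obtain ⟨K, L, hIK, hLN, hK, x, hx, hix, he'⟩ := exists_increasingFlip_of_flipLT hIN hi hN
      have hNJ' : FlipLE N J := Or.inl hNJ
      obtain ⟨-, rfl⟩ := eq_of_flip_between (hinj I) hi hj hij he hK hx hix he'
        hIK (hLN.trans hNJ')
      exact not_flipLT_self N (by simpa [hNJ'.antisymm hLN] using hNJ)

end BrickQuotient

/-! ### The quotient of the weak order -/

theorem mainTheorem4 {B : Type*} {W : Type*} [Group W] [Finite W] {M : CoxeterMatrix B}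
    (cs : CoxeterSystem M W) (C : BrickQuotient.GenCartanMatrix M)
    {m : ℕ} (Q : Fin m → B)
    (hQ : BrickQuotient.demazure cs (List.ofFn Q) = BrickQuotient.longest cs)
    (hreal : BrickQuotient.IsRealizing C cs Q) :
    ∃ κ : W → BrickQuotient.Facet cs Q,
      -- `κ w` is the unique facet whose root configuration is contained in `w(Φ⁺)`
      (∀ (w : W) (I : BrickQuotient.Facet cs Q),
        κ w = I ↔ BrickQuotient.RootConfigIn C cs I w) ∧
      -- covers of the increasing flip order are the images of covers of the weak order
      (∀ I J : BrickQuotient.Facet cs Q,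
        BrickQuotient.CoveredBy BrickQuotient.FlipLT I J ↔
          I ≠ J ∧ ∃ wI wJ : W, κ wI = I ∧ κ wJ = J ∧
            BrickQuotient.CoveredBy (BrickQuotient.WeakLT cs) wI wJ) ∧
      -- the increasing flip order is the quotient of the weak order by the fibers of `κ`
      Function.Surjective κ ∧
      (∀ I J : BrickQuotient.Facet cs Q,
        BrickQuotient.FlipLE I J ↔
          Relation.TransGen (fun K L => ∃ u w : W, κ u = K ∧ κ w = L ∧
            BrickQuotient.WeakLE cs u w) I J) := by
  have hinj := BrickQuotient.rootRefl_injOn_of_isRealizing C hreal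
  choose κ hκ huniq using BrickQuotient.existsUnique_rootConfigIn C hinj hQ
  have hκiff : ∀ (w : W) (I : BrickQuotient.Facet cs Q),
      κ w = I ↔ BrickQuotient.RootConfigIn C cs I w :=
    fun w I => ⟨fun h => h ▸ hκ w, fun h => (huniq w I h).symm⟩
  have hsurj : Function.Surjective κ := fun I =>
    (BrickQuotient.exists_rootConfigIn C hreal I).imp fun w hw => (hκiff w I).2 hw
  have hstep : ∀ (w : W) (s : B), cs.length w < cs.length (w * cs.simple s) →
      κ w = κ (w * cs.simple s) ∨ BrickQuotient.IncreasingFlip (κ w) (κ (w * cs.simple s)) :=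
    fun w s hs => BrickQuotient.eq_or_increasingFlip_of_cover C hreal hs (hκ w) (hκ _) (huniq _)
  refine ⟨κ, hκiff, fun I J => ?_, hsurj, fun I J => ?_⟩
  · rw [BrickQuotient.coveredBy_flipLT_iff hinj]
    constructor
    · intro h
      obtain ⟨w, s, hs, hI, hJ⟩ := BrickQuotient.exists_cover_of_increasingFlip C hreal h
      exact ⟨h.ne, w, _, (hκiff _ _).2 hI, (hκiff _ _).2 hJ,
        (BrickQuotient.coveredBy_weakLT_iff cs).2 ⟨s, hs, rfl⟩⟩
    · rintro ⟨hne, wI, wJ, rfl, rfl, hcov⟩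
      obtain ⟨s, hs, rfl⟩ := (BrickQuotient.coveredBy_weakLT_iff cs).1 hcov
      exact (hstep wI s hs).resolve_left hne
  · constructor
    · rintro (h | rfl)
      · refine Relation.TransGen.mono (fun K L h => ?_) _ _ h
        obtain ⟨w, s, hs, hK, hL⟩ := BrickQuotient.exists_cover_of_increasingFlip C hreal h
        exact ⟨w, _, (hκiff _ _).2 hK, (hκiff _ _).2 hL, BrickQuotient.weakLE_mul_simple cs hs⟩
      · obtain ⟨w, rfl⟩ := hsurj I
        exact Relation.TransGen.single ⟨w, w, rfl, rfl, 1, mul_one w, by simp⟩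
    -- κ is order preserving: climb from u to w by covers, each of which κ sends to an equality or
    -- an increasing flip.
    · have hle : ∀ u w : W, BrickQuotient.WeakLE cs u w → BrickQuotient.FlipLE (κ u) (κ w) := by
        intro u w h
        refine h.induction cs (R := fun u w => BrickQuotient.FlipLE (κ u) (κ w))
          (fun u => BrickQuotient.FlipLE.refl _) (fun u s w hs hw => ?_)
        rcases hstep u s hs with h1 | h1
        · rw [h1]; exact hw
        · exact BrickQuotient.FlipLE.trans (Or.inl (Relation.TransGen.single h1)) hw
      intro h
      induction h with
      | single h =>
        obtain ⟨u, w, rfl, rfl, huw⟩ := h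
        exact hle u w huw
      | tail _ h ih =>
        obtain ⟨u, w, rfl, rfl, huw⟩ := h
        exact ih.trans (hle u w huw)
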